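/- Let $K$ be a field and $Q$ a finite acyclic quiver with vertices $1,\dots,n$ that are naturally labelled, i.e. $i<j$ whenever $i\neq j$ and there is a path from $i$ to $j$. Let $A=KQ/I$ with $I$ an admissible ideal of the path algebra $KQ$ (paths are composed from left to right), let $e_1,\dots,e_n$ be the idempotents of $A$ given by the vertices, and for finitely generated right $A$-modules write $P(i)=e_iA$ and $I(i)=\operatorname{Hom}_K(Ae_i,K)$. Assume that $A$ is Auslander regular, i.e. $A$ has finite global dimension, the right module $A_A$ has finite injective dimension, and the terms of a minimal injective coresolution $0\to A_A\to I^0\to I^1\to\cdots$ satisfy $\operatorname{pdim} I^i\le i$ for all $i\ge 0$. Let $\omega_A=(\dim_K e_jAe_i)_{i,j}$ be the Cartan matrix and $C_A=-\omega_A^T\omega_A^{-1}$ the Coxeter matrix of $A$. A Bruhat decomposition of an invertible real $n\times n$ matrix $M$ is a factorisation $M=U_1PU_2$ with $U_1,U_2$ upper triangular and $P$ a permutation matrix; $P$ is uniquely determined by $M$. The Coxeter permutation $p_A$ of $A$ is the permutation with $p_A(i)=j$ if the unique non-zero entry in column $i$ of the matrix $P$ belonging to $M=C_A$ lies in row $j$.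 The Auslander–Reiten permutation $\hat\psi$ of $A$ is the permutation with $\hat\psi(i)=j$ if $\Omega^{d}(I(i))\cong P(j)$, where $d=\operatorname{pdim} I(i)$ and $\Omega^d$ is the $d$-th syzygy in a minimal projective resolution. Then $C_A$ is invertible and has a Bruhat decomposition $C_A=U_1PU_2$ with $U_1=\mathrm{id}$. Moreover, the Coxeter permutation and the Auslander–Reiten permutation of $A$ are well defined, and they coincide: $p_A=\hat\psi$. -/

import Mathlib

open CategoryTheory

universe u v w

/-! ### The path algebra of a quiver -/

/-- A path of the quiver `V`, together with its source vertex and its end vertex. -/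
structure QuiverPath (V : Type v) [Quiver.{w} V] where
  source : V
  target : V
  path : Quiver.Path source target

/-- The underlying vector space of the path algebra `K V`: it has the paths of `V` as a basis. -/
def PathAlgebra (K : Type u) (V : Type v) [Field K] [Quiver.{w} V] : Type (max u v w) :=
  QuiverPath V →₀ K

namespace PathAlgebra

noncomputable section

variable {K : Type u} {V : Type v} [Field K] [Quiver.{w} V]

instance : AddCommGroup (PathAlgebra K V) := inferInstanceAs (AddCommGroup (QuiverPath V →₀ K))

instance : Module K (PathAlgebra K V) := inferInstanceAs (Module K (QuiverPath V →₀ K))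

/-- The basis of the path algebra that consists of the paths. -/
def basis : Module.Basis (QuiverPath V) K (PathAlgebra K V) :=
  Module.Basis.ofRepr (LinearEquiv.refl K (QuiverPath V →₀ K))

/-- The basis element of the path algebra given by a path. -/
def ofPath (p : QuiverPath V) : PathAlgebra K V := basis p

/-- The coefficient of an element of the path algebra at a path. -/
def coeff (x : PathAlgebra K V) (p : QuiverPath V) : K := basis.repr x p

theorem induction_linear {motive : PathAlgebra K V → Prop} (x : PathAlgebra K V)
    (zero : motive 0) (add : ∀ x y, motive x → motive y → motive (x + y))
    (smul : ∀ (c : K) (p : QuiverPath V), motive (c • ofPath p)) : motive x := by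
  obtain ⟨f, rfl⟩ := basis.repr.symm.surjective x
  induction f using Finsupp.induction_linear with
  | zero => simpa using zero
  | add f g hf hg => simpa using add _ _ hf hg
  | single p c => simpa [ofPath] using smul c p

/-- The idempotent of the path algebra that belongs to the vertex `i`, the path of length zero. -/
def vertex (i : V) : PathAlgebra K V := ofPath ⟨i, i, Quiver.Path.nil⟩

instance [Fintype V] : One (PathAlgebra K V) := ⟨∑ i, vertex i⟩

theorem one_def [Fintype V] : (1 : PathAlgebra K V) = ∑ i, vertex i := rfl

variable [DecidableEq V]

/-- The product of two paths: `p q` is "first `p`, then `q`" if `p` ends where `q` starts, and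
it is zero otherwise. -/
def pathMul (p q : QuiverPath V) : PathAlgebra K V :=
  if h : p.target = q.source then ofPath ⟨p.source, q.target, p.path.comp (q.path.cast h.symm rfl)⟩
  else 0

/-- The product of the path algebra as a bilinear map: the bilinear extension of the product of
paths. -/
def mulHom : PathAlgebra K V →ₗ[K] PathAlgebra K V →ₗ[K] PathAlgebra K V :=
  basis.constr K fun p => basis.constr K fun q => pathMul p q

instance : Mul (PathAlgebra K V) := ⟨fun x y => mulHom x y⟩

theorem mul_def (x y : PathAlgebra K V) : x * y = mulHom x y := rfl

theorem ofPath_mul_ofPath (p q : QuiverPath V) :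
    (ofPath p * ofPath q : PathAlgebra K V) = pathMul p q := by
  simp [mul_def, mulHom, ofPath]

theorem pathMul_of_eq {a b c : V} (p : Quiver.Path a b) (q : Quiver.Path b c) :
    (pathMul ⟨a, b, p⟩ ⟨b, c, q⟩ : PathAlgebra K V) = ofPath ⟨a, c, p.comp q⟩ := by
  simp [pathMul]

theorem pathMul_of_ne {p q : QuiverPath V} (h : p.target ≠ q.source) :
    (pathMul p q : PathAlgebra K V) = 0 := by
  simp [pathMul, h]

theorem mulHom_assoc (x y z : PathAlgebra K V) :
    mulHom (mulHom x y) z = mulHom x (mulHom y z) := by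
  induction x using induction_linear with
  | zero => simp
  | add x₁ x₂ h₁ h₂ => simp [h₁, h₂]
  | smul c p =>
  induction y using induction_linear with
  | zero => simp
  | add x₁ x₂ h₁ h₂ => simp only [map_add, LinearMap.add_apply, h₁, h₂]
  | smul c' q =>
  induction z using induction_linear with
  | zero => simp
  | add x₁ x₂ h₁ h₂ => simp only [map_add, h₁, h₂]
  | smul c'' r =>
  simp only [map_smul, LinearMap.smul_apply]
  congr 3
  simp only [← mul_def, ofPath_mul_ofPath]
  obtain ⟨a, b, p⟩ := p
  obtain ⟨b', c, q⟩ := q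
  obtain ⟨c', d, r⟩ := r
  by_cases h : b = b'
  · subst h
    by_cases h' : c = c'
    · subst h'
      simp only [pathMul_of_eq, ofPath_mul_ofPath, Quiver.Path.comp_assoc]
    · rw [pathMul_of_ne (p := ⟨b, c, q⟩) h', pathMul_of_eq, ofPath_mul_ofPath, pathMul_of_ne h',
        mul_def, map_zero]
  · rw [pathMul_of_ne (p := ⟨a, b, p⟩) h, mul_def, mul_def, map_zero, LinearMap.zero_apply]
    by_cases h' : c = c'
    · subst h'
      rw [pathMul_of_eq, ← mul_def, ofPath_mul_ofPath, pathMul_of_ne h]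
    · rw [pathMul_of_ne h', map_zero]

variable [Fintype V]

theorem mulHom_one_left (x : PathAlgebra K V) : mulHom 1 x = x := by
  induction x using induction_linear with
  | zero => simp
  | add x₁ x₂ h₁ h₂ => simp only [map_add, h₁, h₂]
  | smul c p =>
  rw [map_smul, one_def, map_sum, LinearMap.sum_apply]
  congr 1
  obtain ⟨a, b, p⟩ := p
  rw [Finset.sum_eq_single a]
  · rw [vertex, ← mul_def, ofPath_mul_ofPath, pathMul_of_eq, Quiver.Path.nil_comp]
  · intro i _ hi
    rw [vertex, ← mul_def, ofPath_mul_ofPath, pathMul_of_ne hi]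
  · simp

theorem mulHom_one_right (x : PathAlgebra K V) : mulHom x 1 = x := by
  induction x using induction_linear with
  | zero => simp
  | add x₁ x₂ h₁ h₂ => simp only [map_add, LinearMap.add_apply, h₁, h₂]
  | smul c p =>
  rw [map_smul, LinearMap.smul_apply, one_def, map_sum]
  congr 1
  obtain ⟨a, b, p⟩ := p
  rw [Finset.sum_eq_single b]
  · rw [vertex, ← mul_def, ofPath_mul_ofPath, pathMul_of_eq, Quiver.Path.comp_nil]
  · intro i _ hi
    rw [vertex, ← mul_def, ofPath_mul_ofPath, pathMul_of_ne (Ne.symm hi)]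
  · simp

instance : Ring (PathAlgebra K V) where
  __ := (inferInstance : AddCommGroup (PathAlgebra K V))
  __ := (inferInstance : Mul (PathAlgebra K V))
  __ := (inferInstance : One (PathAlgebra K V))
  mul_assoc := mulHom_assoc
  one_mul := mulHom_one_left
  mul_one := mulHom_one_right
  zero_mul x := by rw [mul_def, map_zero, LinearMap.zero_apply]
  mul_zero x := by rw [mul_def, map_zero]
  left_distrib x y z := by rw [mul_def, map_add]; rfl
  right_distrib x y z := by rw [mul_def, map_add]; rfl

instance : Algebra K (PathAlgebra K V) :=
  Algebra.ofModule (fun c x y => by simp [mul_def]) (fun c x y => by simp [mul_def])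

end

end PathAlgebra

/-! ### Quiver algebras `KQ/I` -/

section QuiverAlgebra

variable {K : Type u} {V : Type v} [Field K] [Quiver.{w} V] [Fintype V] [DecidableEq V]

/-- The quiver `V` is acyclic: it has no oriented cycles (in particular no loops). -/
def IsAcyclicQuiver (V : Type v) [Quiver.{w} V] : Prop :=
  ∀ (i : V) (p : Quiver.Path i i), p.length = 0

/-- The labelling of the vertices by `0, …, n - 1` is natural: if there is a path from `i` to
`j ≠ i`, then `i` comes before `j`. -/
def IsNaturalLabelling {n : ℕ} (label : Fin n ≃ V) : Prop :=
  ∀ i j : Fin n, i ≠ j → Nonempty (Quiver.Path (label i) (label j)) → i < j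

/-- The ideal `I` of the path algebra is admissible: `J ^ m ⊆ I ⊆ J ^ 2` for some `m ≥ 2`. Here
`J` is the ideal generated by the arrows, so that `J ^ m` is the span of the paths of length at
least `m`. -/
structure IsAdmissible (I : Ideal (PathAlgebra K V)) : Prop where
  le_sq : ∀ x ∈ I, ∀ p : QuiverPath V, x.coeff p ≠ 0 → 2 ≤ p.path.length
  pow_le : ∃ m : ℕ, 2 ≤ m ∧
    ∀ p : QuiverPath V, m ≤ p.path.length → (PathAlgebra.ofPath p : PathAlgebra K V) ∈ I

/-- The primitive idempotent `e_i` of the quiver algebra `KQ/I` that belongs to the vertex `i`. -/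
noncomputable def idem (I : Ideal (PathAlgebra K V)) [I.IsTwoSided] (i : V) : PathAlgebra K V ⧸ I :=
  Ideal.Quotient.mk I (PathAlgebra.vertex i)

end QuiverAlgebra

/-! ### Homological algebra of right modules

Right modules over `A` are modules over `Aᵐᵒᵖ`. -/

section Homological

variable {R : Type u} [Ring R]

/-- A submodule is essential if it meets every non-zero submodule. -/
def IsEssentialSubmodule {M : Type v} [AddCommGroup M] [Module R M] (N : Submodule R M) : Prop :=
  ∀ U : Submodule R M, N ⊓ U = ⊥ → U = ⊥

/-- A submodule `N` of `M` is superfluous if `N + U = M` only holds for `U = M`. -/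
def IsSuperfluousSubmodule {M : Type v} [AddCommGroup M] [Module R M] (N : Submodule R M) :
    Prop :=
  ∀ U : Submodule R M, N ⊔ U = ⊤ → U = ⊤

/-- A minimal injective coresolution `0 → M → I⁰ → I¹ → ⋯`: an exact sequence with injective terms
in which the kernel of each `Iⁱ → Iⁱ⁺¹` (the `i`-th cosyzygy of `M`) is essential in `Iⁱ`. -/
structure MinimalInjectiveCoresolution (M : ModuleCat.{u} R) where
  I : ℕ → ModuleCat.{u} R
  ι : M ⟶ I 0
  d : ∀ i, I i ⟶ I (i + 1)
  injective : ∀ i, Injective (I i)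
  ι_injective : Function.Injective ι
  exact_zero : Function.Exact ι (d 0)
  exact_succ : ∀ i, Function.Exact (d i) (d (i + 1))
  minimal : ∀ i, IsEssentialSubmodule (LinearMap.ker (d i).hom)

/-- A minimal projective resolution `⋯ → P₁ → P₀ → M → 0`: an exact sequence with projective terms
in which the kernels of `P₀ → M` and of each `Pᵢ₊₁ → Pᵢ` are superfluous. -/
structure MinimalProjectiveResolution (M : ModuleCat.{u} R) where
  P : ℕ → ModuleCat.{u} R
  π : P 0 ⟶ M
  d : ∀ i, P (i + 1) ⟶ P i
  projective : ∀ i, Projective (P i)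
  π_surjective : Function.Surjective π
  exact_zero : Function.Exact (d 0) π
  exact_succ : ∀ i, Function.Exact (d (i + 1)) (d i)
  minimal_zero : IsSuperfluousSubmodule (LinearMap.ker π.hom)
  minimal_succ : ∀ i, IsSuperfluousSubmodule (LinearMap.ker (d i).hom)

/-- The syzygies `Ω⁰ M = M`, `Ω¹ M = ker (P₀ → M)`, `Ωⁱ⁺² M = ker (Pᵢ₊₁ → Pᵢ)` of a module `M` with
a given minimal projective resolution. -/
def MinimalProjectiveResolution.syzygy {M : ModuleCat.{u} R} (r : MinimalProjectiveResolution M) :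
    ℕ → ModuleCat.{u} R
  | 0 => M
  | 1 => ModuleCat.of R (LinearMap.ker r.π.hom)
  | i + 2 => ModuleCat.of R (LinearMap.ker (r.d i).hom)

/-- The finite dimensional algebra `A` is Auslander-Gorenstein: the right module `A` has finite
injective dimension, and the terms of a minimal injective coresolution
`0 → A → I⁰ → I¹ → ⋯` of it satisfy `pdim Iⁱ ≤ i` for all `i`. -/
structure IsAuslanderGorenstein (A : Type u) [Ring A] : Prop where
  finite_injectiveDimension : ∃ d : ℕ, HasInjectiveDimensionLE (ModuleCat.of Aᵐᵒᵖ A) d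
  gorenstein : ∃ r : MinimalInjectiveCoresolution (ModuleCat.of Aᵐᵒᵖ A),
    ∀ i : ℕ, HasProjectiveDimensionLE (r.I i) i

/-- The finite dimensional algebra `A` is Auslander regular: it is Auslander-Gorenstein and has
finite global dimension. -/
structure IsAuslanderRegular (A : Type u) [Ring A] : Prop extends IsAuslanderGorenstein A where
  finite_globalDimension : ∃ d : ℕ, ∀ M : ModuleCat.{u} Aᵐᵒᵖ, Module.Finite Aᵐᵒᵖ M →
    HasProjectiveDimensionLE M d

end Homological

/-! ### Indecomposable projective and injective right modules -/

section Modules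

/-- The right module `D M = Hom_K(M, K)` that is dual to a left `A`-module `M`; the action of `A`
is `(f a)(x) = f (a x)`. -/
def KDual (K : Type u) (M : Type v) [Field K] [AddCommGroup M] [Module K M] : Type (max u v) :=
  M →ₗ[K] K

noncomputable section

instance (K : Type u) (M : Type v) [Field K] [AddCommGroup M] [Module K M] :
    AddCommGroup (KDual K M) := inferInstanceAs (AddCommGroup (M →ₗ[K] K))

instance (K : Type u) (A : Type w) (M : Type v) [Field K] [Ring A] [Algebra K A] [AddCommGroup M]
    [Module K M] [Module A M] [IsScalarTower K A M] : Module Aᵐᵒᵖ (KDual K M) where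
  smul a f := (show M →ₗ[K] K from f) ∘ₗ Algebra.lsmul K K M a.unop
  one_smul f := LinearMap.ext fun x => congrArg (show M →ₗ[K] K from f) (one_smul A x)
  mul_smul a b f := LinearMap.ext fun x =>
    congrArg (show M →ₗ[K] K from f) (mul_smul b.unop a.unop x)
  smul_zero _ := LinearMap.ext fun _ => rfl
  smul_add _ _ _ := LinearMap.ext fun _ => rfl
  add_smul a b f := LinearMap.ext fun x =>
    (congrArg (show M →ₗ[K] K from f) (add_smul a.unop b.unop x)).trans (map_add _ _ _)
  zero_smul f := LinearMap.ext fun x =>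
    (congrArg (show M →ₗ[K] K from f) (zero_smul A x)).trans (map_zero _)

variable {K : Type u} {V : Type v} [Field K] [Quiver.{w} V] [Fintype V] [DecidableEq V]

/-- The indecomposable projective right module `P(i) = e_i A` of `A = KQ/I`. -/
def projModule (I : Ideal (PathAlgebra K V)) [I.IsTwoSided] (i : V) :
    ModuleCat.{max u v w} (PathAlgebra K V ⧸ I)ᵐᵒᵖ :=
  ModuleCat.of _ (Submodule.span (PathAlgebra K V ⧸ I)ᵐᵒᵖ {idem I i})

/-- The indecomposable injective right module `I(i) = D(A e_i)` of `A = KQ/I`. -/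
def injModule (I : Ideal (PathAlgebra K V)) [I.IsTwoSided] (i : V) :
    ModuleCat.{max u v w} (PathAlgebra K V ⧸ I)ᵐᵒᵖ :=
  ModuleCat.of _ (KDual K (Submodule.span (PathAlgebra K V ⧸ I) {idem I i}))

/-! ### The Auslander-Reiten permutation -/

/-- `p` is the Auslander-Reiten permutation of `A = KQ/I` with respect to the given labelling of
the vertices: `Ω^d I(i) ≅ P(p i)`, where `d` is the projective dimension of `I(i)`. -/
def IsAuslanderReitenPermutation (I : Ideal (PathAlgebra K V)) [I.IsTwoSided] {n : ℕ}
    (label : Fin n ≃ V) (p : Equiv.Perm (Fin n)) : Prop :=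
  ∀ i : Fin n, ∃ (d : ℕ) (r : MinimalProjectiveResolution (injModule I (label i))),
    projectiveDimension (injModule I (label i)) = d ∧
      Nonempty (r.syzygy d ≅ projModule I (label (p i)))

/-! ### The Coxeter matrix and the Coxeter permutation -/

/-- The Cartan matrix `ω` of `A = KQ/I`, with `ω i j = dim_K (e_j A e_i)`. -/
def cartanMatrix (I : Ideal (PathAlgebra K V)) [I.IsTwoSided] {n : ℕ} (label : Fin n ≃ V) :
    Matrix (Fin n) (Fin n) ℝ :=
  Matrix.of fun i j => (Module.finrank K (LinearMap.range
    (LinearMap.mulLeft K (idem I (label j)) ∘ₗ LinearMap.mulRight K (idem I (label i)))) : ℝ)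

/-- The Coxeter matrix `C = -ωᵀ ω⁻¹` of `A = KQ/I`. -/
def coxeterMatrix (I : Ideal (PathAlgebra K V)) [I.IsTwoSided] {n : ℕ} (label : Fin n ≃ V) :
    Matrix (Fin n) (Fin n) ℝ :=
  -((cartanMatrix I label).transpose * (cartanMatrix I label)⁻¹)

end

end Modules

/-- `M = U₁ P U₂` is a Bruhat decomposition of the invertible matrix `M`: `U₁` and `U₂` are upper
triangular and `P` is a permutation matrix. -/
structure IsBruhatDecomposition {n : ℕ} (M U₁ P U₂ : Matrix (Fin n) (Fin n) ℝ) : Prop where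
  isUnit : IsUnit M
  eq_mul : M = U₁ * P * U₂
  upper_left : U₁.IsUpperTriangular
  upper_right : U₂.IsUpperTriangular
  permutation : ∃ s : Equiv.Perm (Fin n), P = s.permMatrix ℝ

/-- `p` is the column-permutation of the permutation matrix `P`: the unique non-zero entry of the
`i`-th column of `P` is in row `p i`. -/
def IsColumnPermutation {n : ℕ} (P : Matrix (Fin n) (Fin n) ℝ) (p : Equiv.Perm (Fin n)) : Prop :=
  ∀ i j : Fin n, P j i ≠ 0 ↔ j = p i

/-- `p` is the Coxeter permutation of `A = KQ/I` with respect to the given labelling of the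
vertices: the column-permutation of the permutation matrix in a Bruhat decomposition of the
Coxeter matrix. -/
def IsCoxeterPermutation {K : Type u} {V : Type v} [Field K] [Quiver.{w} V] [Fintype V]
    [DecidableEq V] (I : Ideal (PathAlgebra K V)) [I.IsTwoSided] {n : ℕ} (label : Fin n ≃ V)
    (p : Equiv.Perm (Fin n)) : Prop :=
  ∃ U₁ P U₂ : Matrix (Fin n) (Fin n) ℝ,
    IsBruhatDecomposition (coxeterMatrix I label) U₁ P U₂ ∧ IsColumnPermutation P p

/-! For an indecomposable projective P put C_0 = P, let E_m be the injective hull of C_m and C_{m+1}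
= E_m / C_m. Since P is a summand of A, each E_m is a summand of I^m, so pdim E_m ≤ m; finite
injective dimension makes some C_m vanish.

The core is that a nonzero summand J of C_m has pdim J = m and Ω^m J ≅ P
(`HullSequence.projectiveDimension_eq`, `HullSequence.nonempty_syzygy_iso`). Dimension shifting
gives pdim J ≤ m. If pdim J < m, then Ext^1(J, C_{m-1}) = 0, so J lifts to a submodule of E_{m-1}
meeting C_{m-1} trivially, against essentiality. For m > 0, the iterated extension in Ext^m(C_m, P)
is universal because Ext^{i+1}(E_i, -) = 0; comparing it with the universal class in Ext^m(J, Ω^m J)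
yields a map P → Ω^m J, surjective by minimality and split because Ω^m J is projective.

The last nonzero C_m equals E_m, so it has some I(j) as a summand. As I(j) determines m and then P,
the assignment k ↦ j is injective, hence a bijection, and its inverse p is the Auslander–Reiten
permutation (`exists_auslanderReiten_perm`).

This bijection is triangular: if I(i) is a summand of a term E_m for P(p(j)), then i ≥ j. Either
I(i) embeds in C_m, which forces i = j, or it maps nontrivially to E_{m+1}, where the socle of the
image produces a summand I(i') with i' ≤ i. Taking dimension vectors along the coresolution, column
p(j) of ω is a combination of the rows i ≥ j. Hence ωᵀω⁻¹ = PB with B upper triangular, and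
uniqueness of the permutation in a Bruhat decomposition identifies it with p. -/

/-! ### Projective covers, injective hulls and minimal resolutions -/

section Covers

variable {R : Type u} [Ring R]

/-- A complemented submodule is a retract. -/
noncomputable def retractOfIsCompl {M : ModuleCat.{u} R} {p q : Submodule R M} (h : IsCompl p q) :
    Retract (ModuleCat.of R p) M where
  i := ModuleCat.ofHom p.subtype
  r := ModuleCat.ofHom (p.projectionOnto q h)
  retract := by
    ext x
    simp

theorem injective_of_retract {X Y : ModuleCat.{u} R} (h : Retract X Y) [Injective Y] :
    Injective X := by
  exact injective_iff_hasInjectiveDimensionLT_one.2 (h.hasInjectiveDimensionLT 1)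

theorem projective_of_retract {X Y : ModuleCat.{u} R} (h : Retract X Y) [Projective Y] :
    Projective X := by
  exact projective_iff_hasProjectiveDimensionLT_one.2 (h.hasProjectiveDimensionLT 1)

variable [IsArtinianRing R] [IsNoetherianRing R]

/-- Fitting's lemma. The exponent is kept positive so that a factor `f` can be split off the power.
-/
theorem exists_isCompl_ker_pow_range_pow {M : Type*} [AddCommGroup M] [Module R M]
    [Module.Finite R M] (f : Module.End R M) :
    ∃ n : ℕ, IsCompl (LinearMap.ker (f ^ (n + 1))) (LinearMap.range (f ^ (n + 1))) := by
  obtain ⟨k, hk⟩ := Filter.eventually_atTop.mp f.eventually_isCompl_ker_pow_range_pow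
  exact ⟨k, hk (k + 1) (by omega)⟩

/-- Finitely generated modules over an artinian ring have projective covers. -/
theorem exists_projectiveCover (M : ModuleCat.{u} R) [Module.Finite R M] :
    ∃ (Q : ModuleCat.{u} R) (π : Q ⟶ M), Module.Finite R Q ∧ Projective Q ∧
      Function.Surjective π ∧ IsSuperfluousSubmodule (LinearMap.ker π.hom) := by
  let S : Set (Σ Q : ModuleCat.{u} R, Q ⟶ M) :=
    {x | Module.Finite R x.1 ∧ Projective x.1 ∧ Function.Surjective x.2}
  have hS : S.Nonempty := by
    obtain ⟨n, f, hf⟩ := Module.Finite.exists_fin' R M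
    exact ⟨⟨ModuleCat.of R (Fin n → R), ModuleCat.ofHom f⟩,
      inferInstanceAs (Module.Finite R (Fin n → R)),
      (IsProjective.iff_projective (R := R) (Fin n → R)).1 inferInstance, hf⟩
  obtain ⟨⟨Q, π⟩, ⟨hQ, hQ', hπ⟩, hmin⟩ :=
    -- A cover is a surjection from a finitely generated projective module of least length.
    (InvImage.wf (fun x : Σ Q : ModuleCat.{u} R, Q ⟶ M => Module.length R x.1)
      wellFounded_lt).has_min S hS
  dsimp only at hQ hQ' hπ
  refine ⟨Q, π, hQ, hQ', hπ, fun U hU => ?_⟩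
  by_contra hne
  have hsurj : Function.Surjective (π.hom ∘ₗ U.subtype) := by
    intro m
    obtain ⟨q, rfl⟩ := hπ m
    obtain ⟨a, ha, b, hb, rfl⟩ := Submodule.mem_sup.1 (hU ▸ Submodule.mem_top : q ∈ _)
    exact ⟨⟨b, hb⟩, by simp [LinearMap.mem_ker.1 ha]⟩
  have := (IsProjective.iff_projective (R := R) Q).2 hQ'
  obtain ⟨h, hh⟩ := Module.projective_lifting_property _ π.hom hsurj
  -- `g` is an endomorphism of `Q` over `M` with image in `U`. The Fitting image of `g` is a
  -- projective summand that still maps onto `M` and is shorter than `Q` when `U` is proper.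
  let g : Module.End R Q := U.subtype ∘ₗ h
  have hg (x : Q) : π.hom (g x) = π.hom x := LinearMap.congr_fun hh x
  have hgn (n : ℕ) (x : Q) : π.hom ((g ^ n) x) = π.hom x := by
    induction n with
    | zero => rfl
    | succ n ih => rw [pow_succ', Module.End.mul_apply, hg, ih]
  obtain ⟨n, hn⟩ := exists_isCompl_ker_pow_range_pow g
  have hle : LinearMap.range (g ^ (n + 1)) ≤ U := by
    rintro _ ⟨x, rfl⟩
    rw [pow_succ', Module.End.mul_apply]
    exact (h _).2
  have hlt : Module.length R (LinearMap.range (g ^ (n + 1))) < Module.length R Q :=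
    Submodule.length_lt fun h => hne (top_le_iff.1 (h ▸ hle))
  refine hmin ⟨ModuleCat.of R (LinearMap.range (g ^ (n + 1))),
    ModuleCat.ofHom (π.hom ∘ₗ Submodule.subtype _)⟩ ⟨?_, ?_, ?_⟩ hlt
  · exact inferInstanceAs (Module.Finite R (LinearMap.range (g ^ (n + 1))))
  · exact projective_of_retract (retractOfIsCompl hn.symm)
  · intro m
    obtain ⟨q, rfl⟩ := hπ m
    exact ⟨⟨_, q, rfl⟩, hgn (n + 1) q⟩

/-- A finitely generated module over an artinian ring that embeds into a finitely generated
injective module has a finitely generated injective hull. -/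
theorem exists_injectiveHull (M : ModuleCat.{u} R)
    (hM : ∃ (E : ModuleCat.{u} R) (ι : M ⟶ E), Module.Finite R E ∧ Injective E ∧
      Function.Injective ι) :
    ∃ (E : ModuleCat.{u} R) (ι : M ⟶ E), Module.Finite R E ∧ Injective E ∧
      Function.Injective ι ∧ IsEssentialSubmodule (LinearMap.range ι.hom) := by
  let S : Set (Σ E : ModuleCat.{u} R, M ⟶ E) :=
    {x | Module.Finite R x.1 ∧ Injective x.1 ∧ Function.Injective x.2}
  have hS : S.Nonempty := by
    obtain ⟨E, ι, h⟩ := hM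
    exact ⟨⟨E, ι⟩, h⟩
  obtain ⟨⟨E, ι⟩, ⟨hE, hE', hι⟩, hmin⟩ :=
    (InvImage.wf (fun x : Σ E : ModuleCat.{u} R, M ⟶ E => Module.length R x.1)
      wellFounded_lt).has_min S hS
  dsimp only at hE hE' hι
  refine ⟨E, ι, hE, hE', hι, fun U hU => ?_⟩
  by_contra hne
  have hinj : Function.Injective (U.mkQ ∘ₗ ι.hom) := by
    rw [← LinearMap.ker_eq_bot, LinearMap.ker_eq_bot']
    intro m hm
    have h1 : ι.hom m ∈ LinearMap.range ι.hom ⊓ U :=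
      ⟨⟨m, rfl⟩, (Submodule.Quotient.mk_eq_zero U).1 hm⟩
    rw [hU, Submodule.mem_bot] at h1
    exact hι (h1.trans (map_zero ι.hom).symm)
  have := (Module.injective_iff_injective_object R E).2 hE'
  obtain ⟨h, hh⟩ := Module.Injective.extension_property R E M (E ⧸ U) _ hinj ι.hom
  -- `g` fixes `M` and kills `U`, so its Fitting image is an injective summand containing `M`,
  -- shorter than `E` when `U ≠ ⊥`.
  let g : Module.End R E := h ∘ₗ U.mkQ
  have hg (x : M) : g (ι.hom x) = ι.hom x := LinearMap.congr_fun hh x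
  have hgn (n : ℕ) (x : M) : (g ^ n) (ι.hom x) = ι.hom x := by
    induction n with
    | zero => rfl
    | succ n ih => rw [pow_succ', Module.End.mul_apply, ih, hg]
  obtain ⟨n, hn⟩ := exists_isCompl_ker_pow_range_pow g
  have hle : U ≤ LinearMap.ker (g ^ (n + 1)) := by
    intro x hx
    rw [LinearMap.mem_ker, pow_succ, Module.End.mul_apply]
    have : g x = 0 := by
      change h (U.mkQ x) = 0
      rw [Submodule.mkQ_apply, (Submodule.Quotient.mk_eq_zero U).2 hx, map_zero]
    rw [this, map_zero]
  have hlt : Module.length R (LinearMap.range (g ^ (n + 1))) < Module.length R E := by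
    refine Submodule.length_lt fun h => hne (le_bot_iff.1 (hle.trans ?_))
    have := hn.inf_eq_bot
    rw [h, inf_top_eq] at this
    exact this.le
  refine hmin ⟨ModuleCat.of R (LinearMap.range (g ^ (n + 1))),
    ModuleCat.ofHom (ι.hom.codRestrict _ fun x => ⟨ι.hom x, hgn _ x⟩)⟩ ⟨?_, ?_, ?_⟩ hlt
  · exact inferInstanceAs (Module.Finite R (LinearMap.range (g ^ (n + 1))))
  · exact injective_of_retract (retractOfIsCompl hn.symm)
  · intro x y hxy
    exact hι (congrArg Subtype.val hxy)

/-- Finitely generated modules over an artinian ring have minimal projective resolutions. -/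
theorem nonempty_minimalProjectiveResolution (M : ModuleCat.{u} R) [Module.Finite R M] :
    Nonempty (MinimalProjectiveResolution M) := by
  choose Q π hfin hproj hsurj hsup using
    fun X : {X : ModuleCat.{u} R // Module.Finite R X} =>
      have := X.2
      exists_projectiveCover X.1
  let step (X : {X : ModuleCat.{u} R // Module.Finite R X}) :
      {X : ModuleCat.{u} R // Module.Finite R X} :=
    ⟨ModuleCat.of R (LinearMap.ker (π X).hom),
      have := hfin X
      inferInstanceAs (Module.Finite R (LinearMap.ker (π X).hom))⟩
  let Z : ℕ → {X : ModuleCat.{u} R // Module.Finite R X} :=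
    Nat.rec ⟨M, inferInstance⟩ fun _ X => step X
  let d (n : ℕ) : Q (Z (n + 1)) ⟶ Q (Z n) :=
    π (Z (n + 1)) ≫ ModuleCat.ofHom (LinearMap.ker (π (Z n)).hom).subtype
  have hker (n : ℕ) : LinearMap.ker (d n).hom = LinearMap.ker (π (Z (n + 1))).hom := by
    ext x
    exact Submodule.coe_eq_zero
  have hrange (n : ℕ) (x : Q (Z n)) : π (Z n) x = 0 ↔ x ∈ Set.range (d n) := by
    constructor
    · intro hx
      obtain ⟨y, hy⟩ := hsurj (Z (n + 1)) ⟨x, hx⟩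
      exact ⟨y, congrArg Subtype.val hy⟩
    · rintro ⟨y, rfl⟩
      exact (π (Z (n + 1)) y).2
  refine ⟨⟨fun n => Q (Z n), π (Z 0), d, fun n => hproj _, hsurj (Z 0), hrange 0, fun n x => ?_,
    hsup (Z 0), fun n => hker n ▸ hsup (Z (n + 1))⟩⟩
  exact (SetLike.ext_iff.1 (hker n) x).trans (hrange (n + 1) x)

/-- A sequence of short exact sequences `0 → C n → E n → C (n + 1) → 0` in which `E n` is an
injective hull of `C n`. -/
structure HullSequence (R : Type u) [Ring R] where
  C : ℕ → ModuleCat.{u} R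
  E : ℕ → ModuleCat.{u} R
  f : ∀ n, C n ⟶ E n
  g : ∀ n, E n ⟶ C (n + 1)
  injective : ∀ n, Injective (E n)
  f_injective : ∀ n, Function.Injective (f n)
  exact : ∀ n, Function.Exact (f n) (g n)
  g_surjective : ∀ n, Function.Surjective (g n)
  essential : ∀ n, IsEssentialSubmodule (LinearMap.range (f n).hom)

/-- Every finitely generated module over an artinian ring has a minimal injective coresolution by
finitely generated modules, provided that finitely generated modules embed into finitely generated
injective ones. -/
theorem exists_hullSequence
    (hR : ∀ M : ModuleCat.{u} R, Module.Finite R M → ∃ (E : ModuleCat.{u} R) (ι : M ⟶ E),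
      Module.Finite R E ∧ Injective E ∧ Function.Injective ι)
    (M : ModuleCat.{u} R) [Module.Finite R M] : ∃ S : HullSequence R, S.C 0 = M ∧
      ∀ n, Module.Finite R (S.E n) := by
  choose E f hfin hinj hf hess using
    fun X : {X : ModuleCat.{u} R // Module.Finite R X} =>
      have := X.2
      exists_injectiveHull X.1 (hR X.1 X.2)
  let step (X : {X : ModuleCat.{u} R // Module.Finite R X}) :
      {X : ModuleCat.{u} R // Module.Finite R X} :=
    ⟨ModuleCat.of R (E X ⧸ LinearMap.range (f X).hom),
      have := hfin X
      inferInstanceAs (Module.Finite R (E X ⧸ LinearMap.range (f X).hom))⟩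
  let Z : ℕ → {X : ModuleCat.{u} R // Module.Finite R X} :=
    Nat.rec ⟨M, inferInstance⟩ fun _ X => step X
  exact ⟨⟨fun n => (Z n).1, fun n => E (Z n), fun n => f (Z n),
    fun n => ModuleCat.ofHom (LinearMap.range (f (Z n)).hom).mkQ,
    fun n => hinj _, fun n => hf _,
    fun n => LinearMap.exact_map_mkQ_range (f (Z n)).hom,
    fun n => Submodule.mkQ_surjective _, fun n => hess _⟩, rfl, fun n => hfin _⟩

end Covers

/-! ### Cosyzygies: functoriality for retracts and dimension shifting -/

namespace HullSequence

variable {R : Type u} [Ring R] (S T : HullSequence R)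

instance (n : ℕ) : Injective (S.E n) := S.injective n

instance (n : ℕ) : Mono (S.f n) := (ModuleCat.mono_iff_injective _).2 (S.f_injective n)

instance (n : ℕ) : Epi (S.g n) := (ModuleCat.epi_iff_surjective _).2 (S.g_surjective n)

theorem f_comp_g (n : ℕ) : S.f n ≫ S.g n = 0 := by
  ext x
  exact (S.exact n).apply_apply_eq_zero x

/-- The short complex `C n ⟶ E n ⟶ C (n + 1)`. -/
abbrev shortComplex (n : ℕ) : ShortComplex (ModuleCat.{u} R) :=
  ShortComplex.mk (S.f n) (S.g n) (S.f_comp_g n)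

theorem shortExact (n : ℕ) : (S.shortComplex n).ShortExact where
  exact := (ShortComplex.ShortExact.moduleCat_exact_iff_function_exact _).2 (S.exact n)
  mono_f := inferInstanceAs (Mono (S.f n))
  epi_g := inferInstanceAs (Epi (S.g n))

theorem exists_desc {n : ℕ} {X : ModuleCat.{u} R} (k : S.E n ⟶ X) (hk : S.f n ≫ k = 0) :
    ∃ l, S.g n ≫ l = k :=
  have := (S.shortExact n).epi_g
  ⟨(S.shortExact n).exact.desc k hk, (S.shortExact n).exact.g_desc k hk⟩

theorem exists_lift {n : ℕ} {X : ModuleCat.{u} R} (k : X ⟶ S.E n) (hk : k ≫ S.g n = 0) :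
    ∃ l, l ≫ S.f n = k :=
  have := (S.shortExact n).mono_f
  ⟨(S.shortExact n).exact.lift k hk, (S.shortExact n).exact.lift_f k hk⟩

/-- A morphism that is injective on an essential submodule is a monomorphism. -/
theorem mono_of_mono_comp {n : ℕ} {X : ModuleCat.{u} R} (k : S.E n ⟶ X)
    (hk : Mono (S.f n ≫ k)) : Mono k := by
  rw [ModuleCat.mono_iff_ker_eq_bot]
  refine S.essential n _ (eq_bot_iff.2 ?_)
  rintro _ ⟨⟨x, rfl⟩, hx⟩
  have : x = 0 := (ModuleCat.mono_iff_injective _).1 hk ((show (S.f n ≫ k) x = 0 from hx).trans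
    (map_zero (S.f n ≫ k).hom).symm)
  simp [this]

-- Extending the two maps of the retract to the hulls gives a composite `i ≫ p` that need not be the
-- identity, but is mono by essentiality and hence split by some `v`. Since `v` fixes `S.C n`, the
-- corrected pair `i`, `p ≫ v` descends to the next cosyzygies. This transfers the bounds on pdim
-- from the coresolution of `A` to that of each `P(k)`.
variable {S T} in
theorem nonempty_retract_step {n : ℕ} (h : Retract (S.C n) (T.C n)) :
    Nonempty (Retract (S.E n) (T.E n)) ∧ Nonempty (Retract (S.C (n + 1)) (T.C (n + 1))) := by
  obtain ⟨i, hi⟩ : ∃ i : S.E n ⟶ T.E n, S.f n ≫ i = h.i ≫ T.f n :=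
    ⟨Injective.factorThru (h.i ≫ T.f n) (S.f n), Injective.comp_factorThru _ _⟩
  obtain ⟨p, hp⟩ : ∃ p : T.E n ⟶ S.E n, T.f n ≫ p = h.r ≫ S.f n :=
    ⟨Injective.factorThru (h.r ≫ S.f n) (T.f n), Injective.comp_factorThru _ _⟩
  have hip : S.f n ≫ i ≫ p = S.f n := by
    rw [← Category.assoc, hi, Category.assoc, hp, h.retract_assoc]
  have : Mono (i ≫ p) := S.mono_of_mono_comp _ (by rw [hip]; infer_instance)
  obtain ⟨v, hv⟩ : ∃ v : S.E n ⟶ S.E n, (i ≫ p) ≫ v = 𝟙 _ :=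
    ⟨Injective.factorThru (𝟙 _) (i ≫ p), Injective.comp_factorThru _ _⟩
  have hfv : S.f n ≫ v = S.f n := by
    conv_lhs => rw [← hip]
    rw [Category.assoc, hv, Category.comp_id]
  refine ⟨⟨⟨i, p ≫ v, by rw [← hv, Category.assoc]⟩⟩, ?_⟩
  obtain ⟨i', hi'⟩ := S.exists_desc (i ≫ T.g n) (by
    rw [← Category.assoc, hi, Category.assoc, T.f_comp_g, Limits.comp_zero])
  obtain ⟨p', hp'⟩ := T.exists_desc ((p ≫ v) ≫ S.g n) (by
    rw [← Category.assoc, ← Category.assoc, hp, Category.assoc, Category.assoc,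
      reassoc_of% hfv, S.f_comp_g, Limits.comp_zero])
  refine ⟨⟨i', p', ?_⟩⟩
  rw [← cancel_epi (S.g n), ← Category.assoc, hi', Category.assoc, hp', ← Category.assoc,
    ← Category.assoc, hv, Category.id_comp, Category.comp_id]

variable {S T} in
theorem nonempty_retract_C (h : Retract (S.C 0) (T.C 0)) (n : ℕ) :
    Nonempty (Retract (S.C n) (T.C n)) := by
  induction n with
  | zero => exact ⟨h⟩
  | succ n ih => exact (nonempty_retract_step ih.some).2

variable {S T} in
theorem nonempty_retract_E (h : Retract (S.C 0) (T.C 0)) (n : ℕ) :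
    Nonempty (Retract (S.E n) (T.E n)) :=
  (nonempty_retract_step (nonempty_retract_C h n).some).1

/-- The sequence of cosyzygies in a minimal injective coresolution. -/
def ofMinimalInjectiveCoresolution {M : ModuleCat.{u} R} (r : MinimalInjectiveCoresolution M) :
    HullSequence R where
  C
    | 0 => M
    | n + 1 => ModuleCat.of R (LinearMap.ker (r.d (n + 1)).hom)
  E := r.I
  f
    | 0 => r.ι
    | n + 1 => ModuleCat.ofHom (LinearMap.ker (r.d (n + 1)).hom).subtype
  g n := ModuleCat.ofHom ((r.d n).hom.codRestrict _ fun x =>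
    (r.exact_succ n).apply_apply_eq_zero x)
  injective := r.injective
  f_injective
    | 0 => r.ι_injective
    | n + 1 => Subtype.val_injective
  exact
    | 0 => fun x => Iff.trans Submodule.coe_eq_zero.symm (r.exact_zero x)
    | n + 1 => fun x => Iff.trans Submodule.coe_eq_zero.symm
        ⟨fun hx => ⟨⟨x, hx⟩, rfl⟩, fun ⟨y, hy⟩ => hy ▸ y.2⟩
  g_surjective n := by
    rintro ⟨x, hx⟩
    obtain ⟨y, hy⟩ := (r.exact_succ n x).1 hx
    exact ⟨y, Subtype.ext hy⟩
  essential
    | 0 => by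
        have := r.minimal 0
        rwa [LinearMap.exact_iff.1 r.exact_zero] at this
    | n + 1 => by simpa using r.minimal (n + 1)

theorem hasProjectiveDimensionLT_C [Projective (S.C 0)]
    (hpd : ∀ i, HasProjectiveDimensionLE (S.E i) i) (n : ℕ) :
    HasProjectiveDimensionLE (S.C n) n := by
  induction n with
  | zero => exact (projective_iff_hasProjectiveDimensionLE_zero _).1 inferInstance
  | succ n ih =>
    exact (S.shortExact n).hasProjectiveDimensionLT_X₃ (n + 1) ih
      (have := hpd n; hasProjectiveDimensionLT_of_ge (S.E n) (n + 1) (n + 1 + 1) (by omega))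

theorem hasInjectiveDimensionLE_C {d : ℕ} (h : HasInjectiveDimensionLE (S.C 0) d) (n k : ℕ)
    (hk : n + k = d) : HasInjectiveDimensionLE (S.C n) k := by
  induction n generalizing k with
  | zero =>
    obtain rfl : k = d := by omega
    exact h
  | succ n ih =>
    exact (S.shortExact n).hasInjectiveDimensionLT_X₃ (k + 1)
      (hasInjectiveDimensionLT_of_ge (S.E n) 1 (k + 1) (by omega)) (ih (k + 1) (by omega))

/-- The hull sequence of a module of finite injective dimension is finite. -/
theorem exists_subsingleton_C (h : ∃ d, HasInjectiveDimensionLE (S.C 0) d) :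
    ∃ n, Subsingleton (S.C n) := by
  obtain ⟨d, h⟩ := h
  have : Injective (S.C d) :=
    injective_iff_hasInjectiveDimensionLT_one.2 (S.hasInjectiveDimensionLE_C h d 0 (by omega))
  obtain ⟨p, hp⟩ : ∃ p : S.E d ⟶ S.C d, S.f d ≫ p = 𝟙 _ :=
    ⟨Injective.factorThru (𝟙 _) (S.f d), Injective.comp_factorThru _ _⟩
  -- A retraction onto the injective module `C d` is also mono by essentiality, so `f d` is an
  -- isomorphism and the next cosyzygy vanishes.
  have hm : Mono p := S.mono_of_mono_comp p (by rw [hp]; infer_instance)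
  have : p ≫ S.f d = 𝟙 _ := by
    rw [← cancel_mono p, Category.assoc, hp, Category.comp_id, Category.id_comp]
  have hg : S.g d = 0 := by
    rw [← Category.id_comp (S.g d), ← this, Category.assoc, S.f_comp_g, Limits.comp_zero]
  refine ⟨d + 1, subsingleton_of_forall_eq 0 fun x => ?_⟩
  obtain ⟨y, rfl⟩ := S.g_surjective d x
  rw [hg]
  rfl

end HullSequence

/-! ### Ext groups of cosyzygies -/

namespace HullSequence

open Abelian

variable {R : Type u} [Ring R] (S : HullSequence R)

/-- If `pdim E i ≤ i` for all `i`, there is a class in `Ext^n (C n, C 0)` from which all classes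
in `Ext^n (C n, N)` arise by composition with a homomorphism `C 0 ⟶ N`. -/
theorem exists_universal_ext (hpd : ∀ i, HasProjectiveDimensionLE (S.E i) i) (n : ℕ) :
    ∃ θ : Ext (S.C n) (S.C 0) n, ∀ (N : ModuleCat.{u} R) (y : Ext (S.C n) N n),
      ∃ h : S.C 0 ⟶ N, θ.comp (Ext.mk₀ h) (add_zero n) = y := by
  induction n with
  | zero => exact ⟨Ext.mk₀ (𝟙 _), fun N y => ⟨Ext.homEquiv₀ y, by simp⟩⟩
  | succ n ih =>
    obtain ⟨θ, hθ⟩ := ih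
    refine ⟨(S.shortExact n).extClass.comp θ (add_comm 1 n), fun N y => ?_⟩
    have := hpd n
    -- `Ext^(n+1) (E n, N) = 0` since `pdim E n ≤ n`, so the connecting map onto `Ext^(n+1) (C
    -- (n+1), N)` is surjective.
    obtain ⟨x, hx⟩ := Ext.contravariant_sequence_exact₃ (S.shortExact n) N y
      (Ext.eq_zero_of_hasProjectiveDimensionLT (X := S.E n) _ (n + 1) le_rfl) (add_comm 1 n)
    obtain ⟨h, rfl⟩ := hθ N x
    exact ⟨h, by rw [← hx, Ext.comp_assoc_of_third_deg_zero]⟩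

/-- A nonzero retract `J` of `C n` satisfies `Ext^n (J, C 0) ≠ 0`. -/
theorem not_hasProjectiveDimensionLT {J : ModuleCat.{u} R} (n : ℕ) (h : Retract J (S.C n))
    (hJ : ¬ Subsingleton J) : ¬ HasProjectiveDimensionLT J n := by
  intro hn
  -- The vanishing of `Ext^n (J, C 0)` is shifted along the injective terms `E q`, as far as `Ext^1`
  -- into the cosyzygy just before `C n`.
  have key (q : ℕ) : ∀ i, q + i = n → ∀ x : Ext J (S.C q) i, 1 ≤ i → x = 0 := by
    induction q with
    | zero =>
      intro i hi x _
      exact x.eq_zero_of_hasProjectiveDimensionLT n (by omega)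
    | succ q ih =>
      intro i hi x hi1
      obtain ⟨y, rfl⟩ := Ext.covariant_sequence_exact₃ J (S.shortExact q) x rfl
        (ih (i + 1) (by omega) _ (by omega))
      obtain ⟨i, rfl⟩ : ∃ k, i = k + 1 := ⟨i - 1, by omega⟩
      rw [Ext.eq_zero_of_injective (I := S.E q) y, Ext.zero_comp]
  obtain _ | n := n
  · have := (hasProjectiveDimensionLT_zero_iff_isZero J).1 hn
    exact hJ (ModuleCat.subsingleton_of_isZero this)
  · obtain ⟨y, hy⟩ := Ext.covariant_sequence_exact₃ J (S.shortExact n) (Ext.mk₀ h.i) (zero_add 1)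
      (key n 1 rfl _ le_rfl)
    obtain ⟨t, rfl⟩ := Ext.homEquiv₀.symm.surjective y
    have ht : t ≫ S.g n = h.i := Ext.homEquiv₀.symm.injective (by simpa using! hy)
    -- `t` lifts the split mono `h.i` along `g n`, so its image meets `ker (g n)`, the image of `f
    -- n`, trivially.
    have hbot : LinearMap.range t.hom = ⊥ := by
      refine S.essential n _ (eq_bot_iff.2 ?_)
      rintro _ ⟨hx, y, rfl⟩
      have h1 : S.g n (t y) = 0 := (S.exact n _).2 hx
      have h2 : h.i y = 0 := by rw [← ht]; exact h1
      have h3 : (h.i ≫ h.r) y = 0 := by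
        change h.r (h.i y) = 0
        rw [h2, map_zero]
      rw [h.retract] at h3
      rw [show y = 0 from h3, map_zero]
      exact zero_mem _
    refine hJ (subsingleton_of_forall_eq 0 fun y => ?_)
    have h1 : t y = 0 := (Submodule.mem_bot R).1 (hbot ▸ ⟨y, rfl⟩)
    have h2 : (h.i ≫ h.r) y = 0 := by
      rw [← ht]
      change h.r (S.g n (t y)) = 0
      rw [h1, map_zero, map_zero]
    rwa [h.retract] at h2

end HullSequence

/-! ### Ext groups and syzygies -/

namespace MinimalProjectiveResolution

open Abelian

variable {R : Type u} [Ring R] {M : ModuleCat.{u} R} (r : MinimalProjectiveResolution M)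

instance (n : ℕ) : Projective (r.P n) := r.projective n

/-- The inclusion of a syzygy. -/
def inclusion : ∀ n, r.syzygy (n + 1) ⟶ r.P n
  | 0 => ModuleCat.ofHom (LinearMap.ker r.π.hom).subtype
  | n + 1 => ModuleCat.ofHom (LinearMap.ker (r.d n).hom).subtype

/-- The projection onto a syzygy. -/
def projection : ∀ n, r.P n ⟶ r.syzygy n
  | 0 => r.π
  | 1 => ModuleCat.ofHom ((r.d 0).hom.codRestrict _ fun x => r.exact_zero.apply_apply_eq_zero x)
  | n + 2 => ModuleCat.ofHom ((r.d (n + 1)).hom.codRestrict _ fun x =>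
      (r.exact_succ n).apply_apply_eq_zero x)

theorem inclusion_injective : ∀ n, Function.Injective (r.inclusion n)
  | 0 => Subtype.val_injective
  | _ + 1 => Subtype.val_injective

theorem projection_surjective : ∀ n, Function.Surjective (r.projection n)
  | 0 => r.π_surjective
  | 1 => by
    rintro ⟨x, hx⟩
    obtain ⟨y, hy⟩ := (r.exact_zero x).1 hx
    exact ⟨y, Subtype.ext hy⟩
  | n + 2 => by
    rintro ⟨x, hx⟩
    obtain ⟨y, hy⟩ := (r.exact_succ n x).1 hx
    exact ⟨y, Subtype.ext hy⟩

theorem exact_inclusion_projection : ∀ n, Function.Exact (r.inclusion n) (r.projection n)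
  | 0 => fun x => ⟨fun hx => ⟨⟨x, hx⟩, rfl⟩, fun ⟨y, hy⟩ => hy ▸ y.2⟩
  | 1 => fun x => Iff.trans Submodule.coe_eq_zero.symm
      ⟨fun hx => ⟨⟨x, hx⟩, rfl⟩, fun ⟨y, hy⟩ => hy ▸ y.2⟩
  | _ + 2 => fun x => Iff.trans Submodule.coe_eq_zero.symm
      ⟨fun hx => ⟨⟨x, hx⟩, rfl⟩, fun ⟨y, hy⟩ => hy ▸ y.2⟩

theorem inclusion_superfluous : ∀ n, IsSuperfluousSubmodule (LinearMap.range (r.inclusion n).hom)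
  | 0 => by
    have := r.minimal_zero
    rwa [← Submodule.range_subtype (LinearMap.ker r.π.hom)] at this
  | n + 1 => by
    have := r.minimal_succ n
    rwa [← Submodule.range_subtype (LinearMap.ker (r.d n).hom)] at this

/-- The short complex `Ω^(n+1) M ⟶ P n ⟶ Ω^n M`. -/
abbrev shortComplex (n : ℕ) : ShortComplex (ModuleCat.{u} R) :=
  ShortComplex.mk (r.inclusion n) (r.projection n)
    (by ext x; exact (r.exact_inclusion_projection n).apply_apply_eq_zero x)

theorem shortExact (n : ℕ) : (r.shortComplex n).ShortExact where
  exact := (ShortComplex.ShortExact.moduleCat_exact_iff_function_exact _).2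
    (r.exact_inclusion_projection n)
  mono_f := (ModuleCat.mono_iff_injective _).2 (r.inclusion_injective n)
  epi_g := (ModuleCat.epi_iff_surjective _).2 (r.projection_surjective n)

theorem hasProjectiveDimensionLE_syzygy {d : ℕ} (h : HasProjectiveDimensionLE M d) (n k : ℕ)
    (hk : n + k = d) : HasProjectiveDimensionLE (r.syzygy n) k := by
  induction n generalizing k with
  | zero =>
    obtain rfl : k = d := by omega
    exact h
  | succ n ih =>
    exact ((r.shortExact n).hasProjectiveDimensionLT_X₃_iff k (r.projective n)).1
      (ih (k + 1) (by omega))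

/-- There is a class in `Ext^n (M, Ω^n M)` from which all classes in `Ext^n (M, N)` arise by
composition with a homomorphism `Ω^n M ⟶ N`; a homomorphism that yields the zero class factors
through the inclusion of `Ω^n M`. -/
theorem exists_universal_ext (n : ℕ) :
    ∃ η : Ext M (r.syzygy (n + 1)) (n + 1),
      (∀ (N : ModuleCat.{u} R) (y : Ext M N (n + 1)),
        ∃ g : r.syzygy (n + 1) ⟶ N, η.comp (Ext.mk₀ g) (add_zero _) = y) ∧
      ∀ (N : ModuleCat.{u} R) (g : r.syzygy (n + 1) ⟶ N),
        η.comp (Ext.mk₀ g) (add_zero _) = 0 → ∃ a : r.P n ⟶ N, g = r.inclusion n ≫ a := by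
  have key (n : ℕ) (N : ModuleCat.{u} R) (g : r.syzygy (n + 1) ⟶ N)
      (hg : (r.shortExact n).extClass.comp (Ext.mk₀ g) (add_zero 1) = 0) :
      ∃ a : r.P n ⟶ N, g = r.inclusion n ≫ a := by
    obtain ⟨a, ha⟩ := Ext.contravariant_sequence_exact₁ (r.shortExact n) N (Ext.mk₀ g)
      (add_zero 1) hg
    obtain ⟨a, rfl⟩ := Ext.homEquiv₀.symm.surjective a
    exact ⟨a, Ext.homEquiv₀.symm.injective (by simpa using! ha.symm)⟩
  have surj (n q : ℕ) (N : ModuleCat.{u} R) (y : Ext (r.syzygy n) N (q + 1)) :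
      ∃ x : Ext (r.syzygy (n + 1)) N q, (r.shortExact n).extClass.comp x (add_comm 1 q) = y :=
    Ext.contravariant_sequence_exact₃ (r.shortExact n) N y
      (Ext.eq_zero_of_projective (P := r.P n) _) (add_comm 1 q)
  have inj (n q : ℕ) (N : ModuleCat.{u} R) (x : Ext (r.syzygy (n + 1)) N (q + 1))
      (hx : (r.shortExact n).extClass.comp x (add_comm 1 (q + 1)) = 0) : x = 0 := by
    obtain ⟨a, rfl⟩ := Ext.contravariant_sequence_exact₁ (r.shortExact n) N x _ hx
    rw [Ext.eq_zero_of_projective (P := r.P n) a, Ext.comp_zero]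
  -- Strengthened induction: composition with `η` is onto in every degree and injective in positive
  -- degrees. Injectivity fails only in degree 0, where the last short exact sequence describes the
  -- kernel through `key`.
  suffices ∀ q, ∃ η : Ext M (r.syzygy q) q,
      (∀ (N : ModuleCat.{u} R) (i j : ℕ) (h : q + i = j) (y : Ext M N j),
        ∃ x : Ext (r.syzygy q) N i, η.comp x h = y) ∧
      ∀ (N : ModuleCat.{u} R) (i j : ℕ) (h : q + (i + 1) = j) (x : Ext (r.syzygy q) N (i + 1)),
        η.comp x h = 0 → x = 0 by
    obtain ⟨η, h1, h2⟩ := this n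
    refine ⟨η.comp (r.shortExact n).extClass rfl, fun N y => ?_, fun N g hg => ?_⟩
    · obtain ⟨x, rfl⟩ := h1 N 1 _ rfl y
      obtain ⟨g, rfl⟩ := surj n 0 N x
      obtain ⟨g, rfl⟩ := Ext.homEquiv₀.symm.surjective g
      exact ⟨g, by rw [Ext.comp_assoc_of_third_deg_zero]; rfl⟩
    · rw [Ext.comp_assoc_of_third_deg_zero] at hg
      exact key n N g (h2 N 0 _ rfl _ hg)
  intro q
  induction q with
  | zero =>
    refine ⟨Ext.mk₀ (𝟙 M), fun N i j h y => ?_, fun N i j h x hx => ?_⟩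
    · obtain rfl : i = j := by omega
      exact ⟨y, y.mk₀_id_comp⟩
    · obtain rfl : i + 1 = j := by omega
      exact (Ext.mk₀_id_comp x).symm.trans hx
  | succ q ih =>
    obtain ⟨η, h1, h2⟩ := ih
    refine ⟨η.comp (r.shortExact q).extClass rfl, fun N i j h y => ?_, fun N i j h x hx => ?_⟩
    · obtain ⟨x, rfl⟩ := h1 N (i + 1) j (by omega) y
      obtain ⟨z, rfl⟩ := surj q i N x
      exact ⟨z, Ext.comp_assoc _ _ _ _ _ (by omega)⟩
    · rw [Ext.comp_assoc _ _ _ rfl (add_comm 1 (i + 1)) (by omega)] at hx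
      exact inj q i N x (h2 N (i + 1) j (by omega) _ hx)

end MinimalProjectiveResolution

/-! ### Syzygies of summands of cosyzygies -/

section

open Abelian

variable {R : Type u} [Ring R]

theorem IsSuperfluousSubmodule.map {M N : Type v} [AddCommGroup M] [AddCommGroup N] [Module R M]
    [Module R N] {X : Submodule R M} (hX : IsSuperfluousSubmodule X) (a : M →ₗ[R] N) :
    IsSuperfluousSubmodule (X.map a) := by
  intro U hU
  have h1 : U.comap a = ⊤ := by
    refine hX _ (eq_top_iff.2 fun x _ => ?_)
    obtain ⟨_, ⟨y, hy, rfl⟩, u, hu, hxu⟩ := Submodule.mem_sup.1 (hU ▸ Submodule.mem_top : a x ∈ _)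
    refine Submodule.mem_sup.2 ⟨y, hy, x - y, ?_, by abel⟩
    simpa [← hxu] using hu
  have h2 : X.map a ≤ U := Submodule.map_le_iff_le_comap.2 (h1 ▸ le_top)
  rwa [sup_eq_right.2 h2] at hU

/-- An object all of whose idempotent endomorphisms are trivial is isomorphic to each of its
nonzero retracts. -/
theorem nonempty_iso_of_retract {X P : ModuleCat.{u} R}
    (hP : ∀ e : P ⟶ P, e ≫ e = e → e = 0 ∨ e = 𝟙 P) (h : Retract X P) (hX : ¬ Subsingleton X) :
    Nonempty (X ≅ P) := by
  obtain he | he := hP (h.r ≫ h.i) (by simp)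
  · refine absurd (ModuleCat.subsingleton_of_isZero ((Limits.IsZero.iff_id_eq_zero X).2 ?_)) hX
    calc 𝟙 X = h.i ≫ (h.r ≫ h.i) ≫ h.r := by simp
      _ = 0 := by rw [he, Limits.zero_comp, Limits.comp_zero]
  · exact ⟨⟨h.i, h.r, h.retract, he⟩⟩

theorem MinimalProjectiveResolution.hasProjectiveDimensionLT {M : ModuleCat.{u} R}
    (r : MinimalProjectiveResolution M) (n k : ℕ) (h : HasProjectiveDimensionLT (r.syzygy n) k) :
    HasProjectiveDimensionLT M (n + k) := by
  induction n generalizing k with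
  | zero => rwa [zero_add]
  | succ n ih =>
    rw [add_assoc, add_comm 1 k]
    exact ih _ ((r.shortExact n).hasProjectiveDimensionLT_X₃ k h
      (hasProjectiveDimensionLT_of_ge (r.P n) 1 (k + 1) (by omega)))

variable (S : HullSequence R) [Projective (S.C 0)]
  (hpd : ∀ i, HasProjectiveDimensionLE (S.E i) i)
  {J : ModuleCat.{u} R} {m : ℕ} (h : Retract J (S.C m)) (hJ : ¬ Subsingleton J)

include hpd h hJ

theorem HullSequence.projectiveDimension_eq : projectiveDimension J = m := by
  have := S.hasProjectiveDimensionLT_C hpd m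
  exact le_antisymm ((projectiveDimension_le_iff _ _).2 (h.hasProjectiveDimensionLT (m + 1)))
    ((projectiveDimension_ge_iff _ _).2 (S.not_hasProjectiveDimensionLT m h hJ))

/-- If `P = C 0` is an indecomposable projective module and `pdim E i ≤ i` for all `i`, then
`Ω^m J ≅ P` for every nonzero retract `J` of the `m`-th cosyzygy of `P`. -/
theorem HullSequence.nonempty_syzygy_iso
    (hind : ∀ e : S.C 0 ⟶ S.C 0, e ≫ e = e → e = 0 ∨ e = 𝟙 (S.C 0))
    (r : MinimalProjectiveResolution J) : Nonempty (r.syzygy m ≅ S.C 0) := by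
  obtain _ | m := m
  · exact nonempty_iso_of_retract hind h hJ
  obtain ⟨θ, hθ⟩ := S.exists_universal_ext hpd (m + 1)
  obtain ⟨η, hη, hη'⟩ := r.exists_universal_ext m
  obtain ⟨k, hk⟩ := hθ _ ((Ext.mk₀ h.r).comp η (zero_add _))
  obtain ⟨g, hg⟩ := hη _ ((Ext.mk₀ h.i).comp θ (zero_add _))
  have hgk : η.comp (Ext.mk₀ (g ≫ k)) (add_zero _) = η := by
    rw [← Ext.mk₀_comp_mk₀, ← Ext.comp_assoc_of_third_deg_zero, hg, Ext.comp_assoc_of_third_deg_zero,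
      hk, Ext.mk₀_comp_mk₀_assoc, h.retract, Ext.mk₀_id_comp]
  -- `g` and `k` compare the two universal classes; as `g ≫ k` fixes `η`, it is the identity up to a
  -- map through `r.P m`.
  obtain ⟨a, ha⟩ := hη' _ (g ≫ k - 𝟙 _) (by
    rw [sub_eq_add_neg, Ext.mk₀_add, Ext.mk₀_neg, Ext.comp_add, Ext.comp_neg, hgk,
      Ext.comp_mk₀_id, add_neg_cancel])
  -- The syzygy is the image of `k` plus the image under `a` of a superfluous submodule, and the
  -- latter is again superfluous.
  have hsurj : Function.Surjective k := by
    refine LinearMap.range_eq_top.1 (((r.inclusion_superfluous m).map a.hom) (LinearMap.range k.hom)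
      (eq_top_iff.2 fun x _ => ?_))
    have hx : k (g x) - x = a (r.inclusion m x) := congr($ha x)
    refine Submodule.mem_sup.2 ⟨-(a (r.inclusion m x)),
      neg_mem ⟨_, ⟨x, rfl⟩, rfl⟩, k (g x), ⟨_, rfl⟩, ?_⟩
    rw [← hx]
    abel
  have : Projective (r.syzygy (m + 1)) := by
    have := S.hasProjectiveDimensionLT_C hpd (m + 1)
    exact (projective_iff_hasProjectiveDimensionLE_zero _).2
      (r.hasProjectiveDimensionLE_syzygy (h.hasProjectiveDimensionLT (m + 1 + 1)) (m + 1) 0 rfl)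
  have : Epi k := (ModuleCat.epi_iff_surjective k).2 hsurj
  -- A zero syzygy would give `pdim J < m + 1`, contrary to the lower bound.
  refine nonempty_iso_of_retract hind ⟨Projective.factorThru (𝟙 _) k, k, by simp⟩ fun hs => ?_
  exact S.not_hasProjectiveDimensionLT _ h hJ (r.hasProjectiveDimensionLT (m + 1) 0
    ((hasProjectiveDimensionLT_zero_iff_isZero _).2 (ModuleCat.isZero_of_subsingleton _)))

end

/-! ### Additive functions on injective modules -/

section Additive

variable {R : Type u} [Ring R]

/-- A function on modules that is additive on short exact sequences of finitely generated
modules. -/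
def IsAdditiveFunction {G : Type*} [AddCommGroup G] (χ : ModuleCat.{u} R → G) : Prop :=
  ∀ ⦃X Y Z : ModuleCat.{u} R⦄ (f : X ⟶ Y) (g : Y ⟶ Z), Module.Finite R Y →
    Function.Injective f → Function.Exact f g → Function.Surjective g → χ Y = χ X + χ Z

variable {G : Type*} [AddCommGroup G] {χ : ModuleCat.{u} R → G} (hχ : IsAdditiveFunction χ)
include hχ

theorem IsAdditiveFunction.eq_zero {X : ModuleCat.{u} R} (hX : Subsingleton X) : χ X = 0 := by
  have := hχ (𝟙 X) (𝟙 X) inferInstance Function.injective_id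
    (fun x => ⟨fun _ => ⟨x, rfl⟩, fun _ => Subsingleton.elim _ _⟩) Function.surjective_id
  simpa using this

/-- The value of an additive function at an injective module is determined by its values at the
summands of this module which belong to a family that contains a summand of every nonzero
injective module. -/
theorem IsAdditiveFunction.mem_of_injective {𝕜 : Type*} [Ring 𝕜] [Module 𝕜 G] [IsArtinianRing R]
    [IsNoetherianRing R] {ι : Type*} {J : ι → ModuleCat.{u} R} (hJ0 : ∀ i, ¬ Subsingleton (J i))
    (hex : ∀ E : ModuleCat.{u} R, Module.Finite R E → Injective E → ¬ Subsingleton E →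
      ∃ i, Nonempty (Retract (J i) E)) (W : Submodule 𝕜 G) (E : ModuleCat.{u} R)
    (hE : Module.Finite R E) (hE' : Injective E)
    (hW : ∀ i, Nonempty (Retract (J i) E) → χ (J i) ∈ W) : χ E ∈ W := by
  induction E using (InvImage.wf (fun E : ModuleCat.{u} R => Module.length R E)
    wellFounded_lt).induction with
  | _ E ih =>
  by_cases h0 : Subsingleton E
  · rw [hχ.eq_zero h0]
    exact zero_mem _
  obtain ⟨i, ⟨h⟩⟩ := hex E hE hE' h0
  have hri (x : J i) : h.r (h.i x) = x := congr($(h.retract) x)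
  let F := ModuleCat.of R (LinearMap.ker h.r.hom)
  have hF : Retract F E :=
    { i := ModuleCat.ofHom (LinearMap.ker h.r.hom).subtype
      r := ModuleCat.ofHom ((LinearMap.id - h.i.hom ∘ₗ h.r.hom).codRestrict _ fun x => by
        have := hri (h.r x)
        simp [this])
      retract := by
        ext x
        have hx : h.r.hom x.1 = 0 := x.2
        change x.1 - h.i.hom (h.r.hom x.1) = x.1
        rw [hx, map_zero, sub_zero] }
  have hlt : Module.length R F < Module.length R E := by
    refine Submodule.length_lt fun ht => hJ0 i (subsingleton_of_forall_eq 0 fun x => ?_)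
    rw [← hri x]
    exact LinearMap.mem_ker.1 (ht ▸ Submodule.mem_top : h.i x ∈ LinearMap.ker h.r.hom)
  rw [hχ (ModuleCat.ofHom (LinearMap.ker h.r.hom).subtype) h.r hE Subtype.val_injective
    (fun x => ⟨fun hx => ⟨⟨x, hx⟩, rfl⟩, fun ⟨y, hy⟩ => hy ▸ y.2⟩) fun x => ⟨_, hri x⟩]
  -- Summands of the complement `F` are summands of `E`, so no uniqueness of decompositions is
  -- required.
  exact add_mem (ih F hlt (inferInstanceAs (Module.Finite R (LinearMap.ker h.r.hom)))
    (injective_of_retract hF) fun j ⟨hj⟩ => hW j ⟨hj.trans hF⟩) (hW i ⟨h⟩)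

end Additive

/-! ### The Auslander–Reiten bijection and its triangularity -/

section Bijection

theorem HullSequence.retract_C_of_comp_eq_zero {R : Type u} [Ring R] {S : HullSequence R}
    {X : ModuleCat.{u} R} {m : ℕ}
    (h : Retract X (S.E m)) (h0 : h.i ≫ S.g m = 0) : Nonempty (Retract X (S.C m)) := by
  obtain ⟨l, hl⟩ := S.exists_lift h.i h0
  exact ⟨⟨l, S.f m ≫ h.r, by rw [← Category.assoc, hl, h.retract]⟩⟩

variable {R : Type u} [Ring R] {n : ℕ}
  {J : Fin n → ModuleCat.{u} R} {T : Fin n → HullSequence R}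
  (hJfin : ∀ i, Module.Finite R (J i)) (hJ0 : ∀ i, ¬ Subsingleton (J i))
  (hex : ∀ E : ModuleCat.{u} R, Module.Finite R E → Injective E → ¬ Subsingleton E →
    ∃ i, Nonempty (Retract (J i) E))
  (hord : ∀ E : ModuleCat.{u} R, Module.Finite R E → Injective E → ∀ i (f : J i ⟶ E), f ≠ 0 →
    ∃ i' ≤ i, Nonempty (Retract (J i') E))
  (hproj : ∀ k, Projective ((T k).C 0))
  (hind : ∀ k, ∀ e : (T k).C 0 ⟶ (T k).C 0, e ≫ e = e → e = 0 ∨ e = 𝟙 _)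
  (hP0 : ∀ k, ¬ Subsingleton ((T k).C 0))
  (hiso : ∀ k l, Nonempty ((T k).C 0 ≅ (T l).C 0) → k = l)
  (hfin : ∀ k m, Module.Finite R ((T k).E m))
  (hpd : ∀ k m, HasProjectiveDimensionLE ((T k).E m) m)
  (hzero : ∀ k, ∃ m, Subsingleton ((T k).C m))

-- The last nonzero cosyzygy fills its injective hull, so an indecomposable summand of the hull is
-- one of the cosyzygy.
include hex hP0 hfin hzero in
theorem exists_retract_cosyzygy (k : Fin n) :
    ∃ j m, Nonempty (Retract (J j) ((T k).C m)) := by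
  classical
  obtain ⟨m, hm⟩ : ∃ m, Nat.find (hzero k) = m + 1 :=
    Nat.exists_eq_succ_of_ne_zero fun h => hP0 k (h ▸ Nat.find_spec (hzero k))
  have h0 : ¬ Subsingleton ((T k).C m) := Nat.find_min (hzero k) (by omega)
  have h1 : Subsingleton ((T k).C (m + 1)) := hm ▸ Nat.find_spec (hzero k)
  obtain ⟨j, ⟨h⟩⟩ := hex ((T k).E m) (hfin k m) ((T k).injective m) fun hs =>
    h0 ((T k).f_injective m).subsingleton
  exact ⟨j, m, (T k).retract_C_of_comp_eq_zero h
    ((ModuleCat.isZero_of_subsingleton _).eq_of_tgt _ _)⟩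

variable [IsArtinianRing R] [IsNoetherianRing R]

-- `J j` determines the degree as its projective dimension, and then the projective module as its
-- syzygy in that degree.
include hJfin hJ0 hproj hind hiso hpd in
theorem eq_of_retract_cosyzygy {j k l : Fin n} {m m' : ℕ} (h : Retract (J j) ((T k).C m))
    (h' : Retract (J j) ((T l).C m')) : k = l := by
  have := hJfin j
  have e := (T k).projectiveDimension_eq (hpd k) h (hJ0 j)
  rw [(T l).projectiveDimension_eq (hpd l) h' (hJ0 j)] at e
  obtain rfl : m' = m := by exact_mod_cast e
  obtain ⟨r⟩ := nonempty_minimalProjectiveResolution (J j)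
  obtain ⟨e₁⟩ := (T k).nonempty_syzygy_iso (hpd k) h (hJ0 j) (hind k) r
  obtain ⟨e₂⟩ := (T l).nonempty_syzygy_iso (hpd l) h' (hJ0 j) (hind l) r
  exact hiso k l ⟨e₁.symm ≪≫ e₂⟩

include hJfin hJ0 hex hord hproj hind hP0 hiso hfin hpd hzero

/-- The Auslander-Reiten bijection: it is given by the syzygies `Ω^d (J j)` with `d = pdim J j`,
and it is triangular with respect to additive functions. -/
theorem exists_auslanderReiten_perm :
    ∃ p : Equiv.Perm (Fin n),
      (∀ j, ∃ m : ℕ, projectiveDimension (J j) = m ∧ ∀ r : MinimalProjectiveResolution (J j),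
        Nonempty (r.syzygy m ≅ (T (p j)).C 0)) ∧
      ∀ χ : ModuleCat.{u} R → (Fin n → ℝ), IsAdditiveFunction χ →
        ∀ j, χ ((T (p j)).C 0) ∈ Submodule.span ℝ ((fun i => χ (J i)) '' Set.Ici j) := by
  choose q hq using exists_retract_cosyzygy hex hP0 hfin hzero
  have hqinj : Function.Injective q := fun k l hkl => by
    obtain ⟨m, ⟨h⟩⟩ := hq k
    obtain ⟨m', ⟨h'⟩⟩ := hq l
    rw [← hkl] at h'
    exact eq_of_retract_cosyzygy hJfin hJ0 hproj hind hiso hpd h h'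
  let e : Equiv.Perm (Fin n) := Equiv.ofBijective q (Finite.injective_iff_bijective.1 hqinj)
  -- `q` leads from projectives to injectives; the permutation goes the other way.
  refine ⟨e.symm, fun j => ?_, fun χ hχ j => ?_⟩
  · obtain ⟨m, ⟨h⟩⟩ := hq (e.symm j)
    rw [show q (e.symm j) = j from e.apply_symm_apply j] at h
    exact ⟨m, (T _).projectiveDimension_eq (hpd _) h (hJ0 j),
      (T _).nonempty_syzygy_iso (hpd _) h (hJ0 j) (hind _)⟩
  · obtain ⟨k, rfl⟩ := e.surjective j
    rw [e.symm_apply_apply]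
    obtain ⟨N, hN⟩ := hzero k
    -- Descending induction on `m`, starting at `C N = 0`, where the essential extension `E N` is
    -- zero too and has no nonzero summand.
    have hle (d m : ℕ) (hd : m + d = N) (i : Fin n) (h : Retract (J i) ((T k).E m)) :
        q k ≤ i := by
      induction d generalizing m i with
      | zero =>
        obtain rfl : m = N := hd
        have : (⊤ : Submodule R ((T k).E m)) = ⊥ := (T k).essential m _ <| by
          rw [inf_top_eq, LinearMap.range_eq_bot]
          ext x
          rw [Subsingleton.elim x 0, map_zero, map_zero]
        refine absurd (subsingleton_of_forall_eq 0 fun x => ?_) (hJ0 i)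
        have h1 : h.i x = 0 := (Submodule.mem_bot R).1 (this ▸ Submodule.mem_top)
        have h2 : h.r (h.i x) = x := congr($(h.retract) x)
        rw [← h2, h1, map_zero]
      | succ d ih =>
        by_cases h0 : h.i ≫ (T k).g m = 0
        · obtain ⟨h1⟩ := (T k).retract_C_of_comp_eq_zero h h0
          obtain ⟨m', ⟨h2⟩⟩ := hq (e.symm i)
          rw [show q (e.symm i) = i from e.apply_symm_apply i] at h2
          obtain rfl := eq_of_retract_cosyzygy hJfin hJ0 hproj hind hiso hpd h1 h2
          exact (e.apply_symm_apply i).le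
        · obtain ⟨i', hi', ⟨h'⟩⟩ := hord ((T k).E (m + 1)) (hfin k _) ((T k).injective _) i
            ((h.i ≫ (T k).g m) ≫ (T k).f (m + 1))
            fun hz => h0 ((cancel_mono ((T k).f (m + 1))).1 (hz.trans Limits.zero_comp.symm))
          exact (ih (m + 1) (by omega) i' h').trans hi'
    -- `χ (C m) = χ (E m) - χ (C (m + 1))`, unwound from `χ (C N) = 0` up to `C 0`.
    have hmem (d m : ℕ) (hd : m + d = N) : χ ((T k).C m) ∈
        Submodule.span ℝ ((fun i => χ (J i)) '' Set.Ici (q k)) := by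
      induction d generalizing m with
      | zero =>
        obtain rfl : m = N := hd
        rw [hχ.eq_zero hN]
        exact zero_mem _
      | succ d ih =>
        have := hχ ((T k).f m) ((T k).g m) (hfin k m) ((T k).f_injective m) ((T k).exact m)
          ((T k).g_surjective m)
        rw [eq_sub_of_add_eq this.symm]
        exact sub_mem (hχ.mem_of_injective hJ0 hex _ _ (hfin k m) ((T k).injective m)
          fun i ⟨hi⟩ => Submodule.subset_span ⟨i, hle _ m hd i hi, rfl⟩) (ih (m + 1) (by omega))
    exact hmem N 0 (by omega)

end Bijection

/-! ### The injective modules D(Ae) -/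

section Dual

open MulOpposite

variable {K : Type u} {A : Type v} [Field K] [Ring A] [Algebra K A]

namespace KDual

section

variable {M : Type w} [AddCommGroup M] [Module K M]

instance : FunLike (KDual K M) M K := inferInstanceAs (FunLike (M →ₗ[K] K) M K)

instance : LinearMapClass (KDual K M) K M K := inferInstanceAs (LinearMapClass (M →ₗ[K] K) K M K)

instance : Module K (KDual K M) := inferInstanceAs (Module K (M →ₗ[K] K))

variable [Module A M] [IsScalarTower K A M]

theorem op_smul_apply (a : A) (f : KDual K M) (x : M) : (op a • f) x = f (a • x) := rfl

theorem smul_apply (c : K) (f : KDual K M) (x : M) : (c • f) x = c * f x := rfl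

theorem ext {f g : KDual K M} (h : ∀ x, f x = g x) : f = g := LinearMap.ext h

theorem zero_apply (x : M) : (0 : KDual K M) x = 0 := rfl

instance : IsScalarTower K Aᵐᵒᵖ (KDual K M) :=
  ⟨fun c a f => ext fun x => by
    rw [← op_unop a, ← op_smul, op_smul_apply, smul_apply, op_smul_apply, smul_assoc, map_smul,
      smul_eq_mul]⟩

end

variable {X : Type*} [AddCommGroup X] [Module K X] [Module Aᵐᵒᵖ X] [IsScalarTower K Aᵐᵒᵖ X]

/-- The homomorphism of right modules `X → D(N)` that is given by a linear form on `X`, for a left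
ideal `N`. -/
def lift (N : Submodule A A) (ψ : X →ₗ[K] K) : X →ₗ[Aᵐᵒᵖ] KDual K N where
  toFun x := show N →ₗ[K] K from
    { toFun b := ψ (op b.1 • x)
      map_add' b c := by simp [add_smul]
      map_smul' c b := by simp }
  map_add' x y := ext fun b => by
    change ψ _ = ψ _ + ψ _
    rw [smul_add, map_add]
  map_smul' a x := ext fun b => by
    change ψ (op b.1 • a • x) = ψ (op (a.unop * b.1) • x)
    rw [smul_smul]
    rfl

theorem lift_apply (N : Submodule A A) (ψ : X →ₗ[K] K) (x : X) (b : N) :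
    lift N ψ x b = ψ (op b.1 • x) := rfl

end KDual

/-- `e` as an element of the left ideal `A e`. -/
def leftGen (e : A) : Submodule.span A {e} := ⟨e, Submodule.mem_span_singleton_self e⟩

theorem mul_eq_of_mem_span {e : A} (he : IsIdempotentElem e) (b : Submodule.span A {e}) :
    b.1 * e = b.1 := by
  obtain ⟨a, ha⟩ := Submodule.mem_span_singleton.1 b.2
  rw [← ha, smul_eq_mul, mul_assoc, he.eq]

theorem smul_leftGen {e : A} (he : IsIdempotentElem e) (b : Submodule.span A {e}) :
    b.1 • leftGen e = b :=
  Subtype.ext (mul_eq_of_mem_span he b)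

theorem mul_eq_of_mem_span_op {e : A} (he : IsIdempotentElem e) (b : Submodule.span Aᵐᵒᵖ {e}) :
    e * b.1 = b.1 := by
  obtain ⟨a, ha⟩ := Submodule.mem_span_singleton.1 b.2
  rw [← ha, ← op_unop a, op_smul_eq_mul, ← mul_assoc, he.eq]

/-- The right module `D(A e)` is injective. -/
theorem KDual.injective_span {e : A} (he : IsIdempotentElem e) :
    Module.Injective Aᵐᵒᵖ (KDual K (Submodule.span A {e})) where
  out X Y _ _ _ _ f hf g := by
    let _ : Module K X := Module.restrictScalars K Aᵐᵒᵖ X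
    let _ : Module K Y := Module.restrictScalars K Aᵐᵒᵖ Y
    have : IsScalarTower K Aᵐᵒᵖ X := IsScalarTower.restrictScalars K Aᵐᵒᵖ X
    have : IsScalarTower K Aᵐᵒᵖ Y := IsScalarTower.restrictScalars K Aᵐᵒᵖ Y
    obtain ⟨p, hp⟩ := LinearMap.exists_leftInverse_of_injective (f.restrictScalars K)
      (LinearMap.ker_eq_bot.2 hf)
    have hp' (x : X) : p (f x) = x := LinearMap.congr_fun hp x
    -- A homomorphism into `D(A e)` is recovered from its evaluation at `e`. This linear form
    -- extends along a `K`-linear retraction of `f`.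
    let φ : X →ₗ[K] K :=
      { toFun x := g x (leftGen e)
        map_add' x y := by rw [map_add]; rfl
        map_smul' c x := by
          change (g.restrictScalars K) (c • x) (leftGen e) = _
          rw [map_smul]
          rfl }
    refine ⟨KDual.lift _ (φ ∘ₗ p), fun x => KDual.ext fun b => ?_⟩
    rw [KDual.lift_apply, ← map_smul f]
    change φ (p (f _)) = _
    rw [hp']
    change g (op b.1 • x) (leftGen e) = _
    rw [map_smul, KDual.op_smul_apply, smul_leftGen he]

end Dual

/-! ### Socles over algebras with triangular idempotents -/

section Triangular

open MulOpposite

variable (K : Type u) {A : Type v} [Field K] [Ring A] [Algebra K A] {n : ℕ}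

/-- A complete system of nonzero orthogonal idempotents `e i` with `e i A e i = K e i` and
`e i A e j = 0` unless `i ≤ j`. -/
structure IsTriangularSystem (e : Fin n → A) : Prop extends CompleteOrthogonalIdempotents e where
  ne_zero : ∀ i, e i ≠ 0
  exists_smul : ∀ i a, ∃ c : K, e i * a * e i = c • e i
  le : ∀ i j a, e i * a * e j ≠ 0 → i ≤ j

/-- The element `u` of a right module spans the zero module or a simple module that belongs to the
idempotent `e`. -/
def IsSocleElement {X : Type*} [AddCommGroup X] [Module K X] [Module Aᵐᵒᵖ X] (e : A) (u : X) :
    Prop :=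
  ∀ (a : A) (c : K), e * a * e = c • e → op a • u = c • u

namespace IsTriangularSystem

variable {K} {e : Fin n → A} (he : IsTriangularSystem K e)
include he

section

variable {X : Type*} [AddCommGroup X] [Module Aᵐᵒᵖ X]

theorem sum_op_smul (x : X) : ∑ i, op (e i) • x = x := by
  rw [← Finset.sum_smul, ← Finset.op_sum, he.complete, op_one, one_smul]

variable [Module K X]

theorem op_smul_of_isSocleElement {l : Fin n} {u : X} (hu : IsSocleElement K (e l) u) :
    op (e l) • u = u := by
  have := hu (e l) 1 (by rw [one_smul, (he.idem l).eq, (he.idem l).eq])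
  rwa [one_smul] at this

variable [IsScalarTower K Aᵐᵒᵖ X]

/-- Choose `l` maximal with `X e_l ≠ 0`: multiplying an element of `X e_l` by `a` can only leave
component `l` towards a larger index, where `X` vanishes. -/
theorem exists_isSocleElement [Nontrivial X] :
    ∃ (l : Fin n) (u : X), u ≠ 0 ∧ IsSocleElement K (e l) u := by
  obtain ⟨x, hx⟩ := exists_ne (0 : X)
  let s : Set (Fin n) := {l | ∃ u : X, op (e l) • u ≠ 0}
  have hs : s.Nonempty := by
    by_contra! h
    refine hx ?_
    rw [← he.sum_op_smul x]
    exact Finset.sum_eq_zero fun i _ => by_contra fun hi => (h ▸ (⟨x, hi⟩ : i ∈ s) : i ∈ (∅ : Set _))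
  obtain ⟨l, ⟨u, hu⟩, hmax⟩ := s.toFinite.exists_maximal hs
  refine ⟨l, op (e l) • u, hu, fun a c hac => ?_⟩
  rw [← he.sum_op_smul (op a • op (e l) • u), Finset.sum_eq_single l]
  · rw [smul_smul, smul_smul, ← op_mul, ← op_mul, ← mul_assoc, hac, op_smul, smul_assoc]
  · intro k _ hk
    by_contra h0
    have h1 : k ∈ s := ⟨_, h0⟩
    have h2 : e l * a * e k ≠ 0 := fun h => h0 (by
      rw [smul_smul, smul_smul, ← op_mul, ← op_mul, ← mul_assoc, h, op_zero, zero_smul])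
    have h3 := he.le l k a h2
    exact hk (le_antisymm (hmax h1 h3) h3)
  · simp

end

/-- `f b` equals `(f b) e_l`-evaluation, a scalar multiple of `f e_l`, so `f` is determined by its
value at the generator. Thus the socle of `D(A e_l)` lives at `l` only. -/
theorem eq_of_isSocleElement {l l' : Fin n} {f : KDual K (Submodule.span A {e l})} (hf : f ≠ 0)
    (h : IsSocleElement K (e l') f) : l = l' ∧ f (leftGen (e l)) ≠ 0 := by
  have h0 : f (leftGen (e l)) ≠ 0 := by
    refine fun h0 => hf (KDual.ext fun b => ?_)
    obtain ⟨c, hc⟩ := he.exists_smul l' b.1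
    rw [← smul_leftGen (he.idem l) b, ← KDual.op_smul_apply, h _ _ hc, KDual.smul_apply, h0,
      mul_zero, KDual.zero_apply]
  refine ⟨?_, h0⟩
  by_contra hne
  refine h0 ?_
  rw [← smul_leftGen (he.idem l) (leftGen (e l)), ← KDual.op_smul_apply]
  change (op (e l) • f) (leftGen (e l)) = 0
  rw [h (e l) 0 (by rw [he.ortho (Ne.symm hne), zero_mul, zero_smul]), zero_smul,
    KDual.zero_apply]

theorem smul_eq_smul_of_isSocleElement {l : Fin n} {f g : KDual K (Submodule.span A {e l})}
    (hf : IsSocleElement K (e l) f) (hg : IsSocleElement K (e l) g) :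
    f (leftGen (e l)) • g = g (leftGen (e l)) • f := by
  refine KDual.ext fun b => ?_
  obtain ⟨c, hc⟩ := he.exists_smul l b.1
  rw [← smul_leftGen (he.idem l) b, KDual.smul_apply, KDual.smul_apply, ← KDual.op_smul_apply,
    ← KDual.op_smul_apply, hf _ _ hc, hg _ _ hc, KDual.smul_apply, KDual.smul_apply]
  ring

theorem nontrivial_dual (l : Fin n) : Nontrivial (KDual K (Submodule.span A {e l})) := by
  obtain ⟨f, hf⟩ : ∃ f : Module.Dual K (Submodule.span A {e l}), f (leftGen (e l)) ≠ 0 := by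
    by_contra! h
    exact he.ne_zero l (congrArg Subtype.val ((Module.forall_dual_apply_eq_zero_iff K _).1 h))
  exact ⟨⟨f, 0, fun h => hf (congrArg (fun g : KDual K _ => g (leftGen (e l))) h)⟩⟩

/-- An injective module with a nonzero socle element that belongs to `e l` has `D(A e l)` as a
direct summand. -/
theorem exists_retraction {X : Type (max u v)} [AddCommGroup X] [Module K X] [Module Aᵐᵒᵖ X]
    [IsScalarTower K Aᵐᵒᵖ X] [Module.Injective Aᵐᵒᵖ X] {l : Fin n} {u : X} (hu0 : u ≠ 0)
    (hu : IsSocleElement K (e l) u) :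
    ∃ (i : KDual K (Submodule.span A {e l}) →ₗ[Aᵐᵒᵖ] X)
      (r : X →ₗ[Aᵐᵒᵖ] KDual K (Submodule.span A {e l})), r ∘ₗ i = LinearMap.id := by
  obtain ⟨ψ, hψ⟩ : ∃ ψ : Module.Dual K X, ψ u ≠ 0 := by
    by_contra! h
    exact hu0 ((Module.forall_dual_apply_eq_zero_iff K _).1 h)
  let g := KDual.lift (Submodule.span A {e l}) ψ
  have hg0 : g u ≠ 0 := fun h => hψ <| by
    have h1 : g u (leftGen (e l)) = 0 := by rw [h, KDual.zero_apply]
    rw [KDual.lift_apply] at h1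
    exact (congrArg ψ (he.op_smul_of_isSocleElement hu)).symm.trans h1
  have hg : IsSocleElement K (e l) (g u) := fun a c hac => by
    rw [← map_smul, hu a c hac]
    exact (g.restrictScalars K).map_smul c u
  let U := Submodule.span Aᵐᵒᵖ {u}
  have hUinj : Function.Injective (g ∘ₗ U.subtype) := by
    rw [← LinearMap.ker_eq_bot, LinearMap.ker_eq_bot']
    rintro ⟨x, hx⟩ h0
    obtain ⟨a, rfl⟩ := Submodule.mem_span_singleton.1 hx
    obtain ⟨c, hc⟩ := he.exists_smul l a.unop
    have h1 : a • u = c • u := hu _ _ hc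
    have h2 : c • g u = 0 := by
      rw [← hg _ _ hc, ← map_smul]
      exact h0
    refine Subtype.ext (h1.trans ?_)
    rw [(smul_eq_zero.1 h2).resolve_right hg0, zero_smul]
    rfl
  obtain ⟨i, hi⟩ := Module.Injective.extension_property Aᵐᵒᵖ X U _ _ hUinj U.subtype
  have hiu : i (g u) = u :=
    LinearMap.congr_fun hi ⟨u, Submodule.mem_span_singleton_self u⟩
  -- A nonzero kernel would contain a socle element, which is proportional to `g u`; but `g ∘ i`
  -- fixes `g u ≠ 0`.
  have hinj : LinearMap.ker (g ∘ₗ i) = ⊥ := by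
    by_contra hne
    have : Nontrivial (LinearMap.ker (g ∘ₗ i)) := Submodule.nontrivial_iff_ne_bot.2 hne
    obtain ⟨l', ⟨f, hf'⟩, hf0, hf⟩ := he.exists_isSocleElement (X := LinearMap.ker (g ∘ₗ i))
    have hf0 : f ≠ 0 := fun h => hf0 (Subtype.ext h)
    have hf : IsSocleElement K (e l') f := fun a c hac => congrArg Subtype.val (hf a c hac)
    obtain ⟨rfl, h1⟩ := he.eq_of_isSocleElement hf0 hf
    have h2 := he.smul_eq_smul_of_isSocleElement hf hg
    have h3 : f (leftGen (e l)) • g u = 0 := by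
      calc f (leftGen (e l)) • g u = ((g ∘ₗ i).restrictScalars K) (f (leftGen (e l)) • g u) := by
            rw [map_smul]
            change _ = _ • g (i (g u))
            rw [hiu]
        _ = 0 := by
            rw [h2, map_smul]
            change _ • (g ∘ₗ i) f = 0
            rw [LinearMap.mem_ker.1 hf', smul_zero]
    exact hg0 ((smul_eq_zero.1 h3).resolve_left h1)
  have := KDual.injective_span (K := K) (he.idem l)
  obtain ⟨v, hv⟩ := Module.Injective.extension_property Aᵐᵒᵖ (KDual K (Submodule.span A {e l}))
    (KDual K (Submodule.span A {e l})) (KDual K (Submodule.span A {e l})) (g ∘ₗ i)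
    (LinearMap.ker_eq_bot.1 hinj) LinearMap.id
  exact ⟨i, v ∘ₗ g, hv⟩

/-- If `l` belongs to a socle element of a quotient of `D(A e i)`, then `l ≤ i`. -/
theorem le_of_isSocleElement {X : Type*} [AddCommGroup X] [Module K X] [Module Aᵐᵒᵖ X]
    [IsScalarTower K Aᵐᵒᵖ X] {i l : Fin n} (f : KDual K (Submodule.span A {e i}) →ₗ[Aᵐᵒᵖ] X)
    {y : KDual K (Submodule.span A {e i})} (h0 : f y ≠ 0) (h : IsSocleElement K (e l) (f y)) :
    l ≤ i := by
  by_contra hli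
  refine h0 ?_
  rw [← he.op_smul_of_isSocleElement h, ← map_smul]
  have : op (e l) • y = 0 := KDual.ext fun b => by
    have hb : e l • b = 0 := by
      refine Subtype.ext ?_
      change e l * b.1 = 0
      rw [← mul_eq_of_mem_span (he.idem i) b, ← mul_assoc]
      by_contra hne
      exact hli (he.le _ _ _ hne)
    rw [KDual.op_smul_apply, hb, map_zero, KDual.zero_apply]
  rw [this, map_zero]

end IsTriangularSystem

end Triangular

/-! ### Dimension vectors -/

section DimVector

open MulOpposite

variable (K : Type u) {A : Type v} [Field K] [Ring A] [Algebra K A] {n : ℕ} (e : Fin n → A)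

/-- The dimension vector `(dim_K M e i)_i` of a right module `M`. -/
noncomputable def dimVector (M : ModuleCat.{w} Aᵐᵒᵖ) (i : Fin n) : ℝ :=
  letI : Module K M := Module.restrictScalars K Aᵐᵒᵖ M
  haveI : IsScalarTower K Aᵐᵒᵖ M := IsScalarTower.restrictScalars K Aᵐᵒᵖ M
  (Module.finrank K (LinearMap.range (Algebra.lsmul K K M (op (e i)))) : ℝ)

theorem dimVector_of (M : Type w) [AddCommGroup M] [inst : Module K M] [Module Aᵐᵒᵖ M]
    [IsScalarTower K Aᵐᵒᵖ M] (i : Fin n) :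
    dimVector K e (ModuleCat.of Aᵐᵒᵖ M) i =
      Module.finrank K (LinearMap.range (Algebra.lsmul K K M (op (e i)))) := by
  have : inst = Module.restrictScalars K Aᵐᵒᵖ M := by
    refine Module.ext' _ _ fun c x => ?_
    rw [← algebraMap_smul Aᵐᵒᵖ c x]
    rfl
  subst this
  rfl

variable {e}

/-- `M ↦ M e` is exact for an idempotent `e`; the count is rank–nullity for `Y e → Z`. -/
theorem isAdditiveFunction_dimVector [Module.Finite K A] (he : ∀ i, IsIdempotentElem (e i)) :
    IsAdditiveFunction (R := Aᵐᵒᵖ) (dimVector.{u, v, v} K e) := by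
  intro X Y Z f g hY hf hfg hg
  let _ : Module K X := Module.restrictScalars K Aᵐᵒᵖ X
  have : IsScalarTower K Aᵐᵒᵖ X := IsScalarTower.restrictScalars K Aᵐᵒᵖ X
  let _ : Module K Y := Module.restrictScalars K Aᵐᵒᵖ Y
  have : IsScalarTower K Aᵐᵒᵖ Y := IsScalarTower.restrictScalars K Aᵐᵒᵖ Y
  let _ : Module K Z := Module.restrictScalars K Aᵐᵒᵖ Z
  have : IsScalarTower K Aᵐᵒᵖ Z := IsScalarTower.restrictScalars K Aᵐᵒᵖ Z
  have : Module.Finite K Y := Module.Finite.trans Aᵐᵒᵖ Y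
  funext i
  change (Module.finrank K _ : ℝ) = Module.finrank K _ + Module.finrank K _
  let ρ := Algebra.lsmul K K Y (op (e i))
  have hρ : ∀ y, ρ (ρ y) = ρ y := fun y => by
    change op (e i) • op (e i) • y = op (e i) • y
    rw [smul_smul, ← op_mul, (he i).eq]
  let g' : LinearMap.range ρ →ₗ[K] Z := g.hom.restrictScalars K ∘ₗ (LinearMap.range ρ).subtype
  have hrange : LinearMap.range g' = LinearMap.range (Algebra.lsmul K K Z (op (e i))) := by
    ext z
    constructor
    · rintro ⟨⟨_, y, rfl⟩, rfl⟩
      exact ⟨g y, (map_smul g.hom (op (e i)) y).symm⟩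
    · rintro ⟨z, rfl⟩
      obtain ⟨y, rfl⟩ := hg z
      exact ⟨⟨_, y, rfl⟩, map_smul g.hom (op (e i)) y⟩
  let f' : LinearMap.range (Algebra.lsmul K K X (op (e i))) →ₗ[K] Y :=
    f.hom.restrictScalars K ∘ₗ Submodule.subtype _
  have hf' : Function.Injective f' := hf.comp Subtype.val_injective
  have hker : (LinearMap.ker g').map (LinearMap.range ρ).subtype = LinearMap.range f' := by
    ext y
    constructor
    · rintro ⟨⟨_, y, rfl⟩, hy, rfl⟩
      obtain ⟨x, hx⟩ := (hfg (ρ y)).1 hy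
      refine ⟨⟨_, x, rfl⟩, (map_smul f.hom (op (e i)) x).trans ?_⟩
      exact (congrArg ρ hx).trans (hρ y)
    · rintro ⟨⟨_, x, rfl⟩, rfl⟩
      exact ⟨⟨_, f x, (map_smul f.hom (op (e i)) x).symm⟩, hfg.apply_apply_eq_zero _, rfl⟩
  have h1 := LinearMap.finrank_range_add_finrank_ker g'
  rw [hrange, ← Submodule.finrank_map_subtype_eq, hker, LinearMap.finrank_range_of_inj hf'] at h1
  rw [← h1]
  push_cast
  ring

end DimVector

/-! ### Projective modules e_iA and Peirce components -/

section Modules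

open MulOpposite

variable (K : Type u) {A : Type v} [Field K] [Ring A] [Algebra K A] {n : ℕ} {e : Fin n → A}

theorem projective_span {e : A} (he : IsIdempotentElem e) :
    Projective (ModuleCat.of Aᵐᵒᵖ (Submodule.span Aᵐᵒᵖ {e})) := by
  let f : Aᵐᵒᵖ →ₗ[Aᵐᵒᵖ] Submodule.span Aᵐᵒᵖ {e} :=
    LinearMap.toSpanSingleton _ _ ⟨e, Submodule.mem_span_singleton_self e⟩
  let g : Submodule.span Aᵐᵒᵖ {e} →ₗ[Aᵐᵒᵖ] Aᵐᵒᵖ :=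
    { toFun x := op x.1
      map_add' _ _ := rfl
      map_smul' _ _ := rfl }
  rw [← IsProjective.iff_projective]
  refine Module.Projective.of_split g f (LinearMap.ext fun x => Subtype.ext ?_)
  exact mul_eq_of_mem_span_op he x

theorem retract_span {e : A} (he : IsIdempotentElem e) :
    Nonempty (Retract (ModuleCat.of Aᵐᵒᵖ (Submodule.span Aᵐᵒᵖ {e})) (ModuleCat.of Aᵐᵒᵖ A)) := by
  let f : A →ₗ[Aᵐᵒᵖ] Submodule.span Aᵐᵒᵖ {e} :=
    { toFun a := ⟨e * a, Submodule.mem_span_singleton.2 ⟨op a, rfl⟩⟩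
      map_add' a b := Subtype.ext (mul_add e a b)
      map_smul' a b := Subtype.ext (mul_assoc e b a.unop).symm }
  exact ⟨⟨ModuleCat.ofHom (Submodule.subtype _), ModuleCat.ofHom f,
    ModuleCat.hom_ext (LinearMap.ext fun x => Subtype.ext (mul_eq_of_mem_span_op he x))⟩⟩

/-- `dim_K e A e'`. -/
noncomputable def peirceDim (a b : A) : ℕ :=
  Module.finrank K (LinearMap.range (LinearMap.mulLeft K a ∘ₗ LinearMap.mulRight K b))

theorem dimVector_span {f : A} (hf : IsIdempotentElem f) (i : Fin n) :
    dimVector K e (ModuleCat.of Aᵐᵒᵖ (Submodule.span Aᵐᵒᵖ {f})) i = peirceDim K f (e i) := by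
  let σ : Submodule.span Aᵐᵒᵖ {f} →ₗ[K] A := (Submodule.subtype _).restrictScalars K
  have hσ : Function.Injective σ := Subtype.val_injective
  rw [dimVector_of, peirceDim, (Submodule.equivMapOfInjective σ hσ _).finrank_eq]
  refine congrArg (fun N : Submodule K A => (Module.finrank K N : ℝ)) ?_
  ext x
  constructor
  · rintro ⟨_, ⟨y, rfl⟩, rfl⟩
    refine ⟨y.1, ?_⟩
    change f * (y.1 * e i) = y.1 * e i
    rw [← mul_assoc, mul_eq_of_mem_span_op hf]
  · rintro ⟨a, rfl⟩
    exact ⟨_, ⟨⟨f * a, Submodule.mem_span_singleton.2 ⟨op a, rfl⟩⟩, rfl⟩, mul_assoc _ _ _⟩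

theorem dimVector_dual {f : A} (hf : IsIdempotentElem f) (i : Fin n) :
    dimVector K e (ModuleCat.of Aᵐᵒᵖ (KDual K (Submodule.span A {f}))) i = peirceDim K (e i) f := by
  let σ : Submodule.span A {f} →ₗ[K] A := (Submodule.subtype _).restrictScalars K
  have hσ : Function.Injective σ := Subtype.val_injective
  rw [dimVector_of, peirceDim]
  refine congrArg Nat.cast ((LinearMap.finrank_range_dualMap_eq_finrank_range
    (Algebra.lsmul K K (Submodule.span A {f}) (e i))).trans ?_)
  rw [(Submodule.equivMapOfInjective σ hσ _).finrank_eq]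
  refine congrArg (fun N : Submodule K A => Module.finrank K N) ?_
  ext x
  constructor
  · rintro ⟨_, ⟨y, rfl⟩, rfl⟩
    exact ⟨y.1, congrArg (e i * ·) (mul_eq_of_mem_span hf y)⟩
  · rintro ⟨a, rfl⟩
    exact ⟨_, ⟨⟨a * f, Submodule.mem_span_singleton.2 ⟨a, rfl⟩⟩, rfl⟩, rfl⟩

namespace IsTriangularSystem

variable {K} (he : IsTriangularSystem K e)
include he

theorem peirceDim_self (i : Fin n) : peirceDim K (e i) (e i) = 1 := by
  refine finrank_eq_one_iff'.2 ⟨⟨e i, e i, ?_⟩, fun h => he.ne_zero i (congrArg Subtype.val h), ?_⟩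
  · change e i * (e i * e i) = e i
    rw [(he.idem i).eq, (he.idem i).eq]
  · rintro ⟨_, a, rfl⟩
    obtain ⟨c, hc⟩ := he.exists_smul i a
    exact ⟨c, Subtype.ext (hc.symm.trans (mul_assoc _ _ _))⟩

theorem peirceDim_eq_zero {i j : Fin n} (h : ¬ i ≤ j) : peirceDim K (e i) (e j) = 0 := by
  have : LinearMap.mulLeft K (e i) ∘ₗ LinearMap.mulRight K (e j) = 0 := by
    ext a
    change e i * (a * e j) = 0
    rw [← mul_assoc]
    exact by_contra fun h0 => h (he.le i j a h0)
  rw [peirceDim, this, LinearMap.range_zero, finrank_bot]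

theorem exists_apply_eq_smul {l : Fin n} (φ : Submodule.span Aᵐᵒᵖ {e l} →ₗ[Aᵐᵒᵖ]
    Submodule.span Aᵐᵒᵖ {e l}) : ∃ c : K, ∀ x, φ x = c • x := by
  let g : Submodule.span Aᵐᵒᵖ {e l} := ⟨e l, Submodule.mem_span_singleton_self _⟩
  have hg : op (e l) • g = g := Subtype.ext (he.idem l)
  obtain ⟨c, hc⟩ := he.exists_smul l (φ g).1
  have hφ : φ g = c • g := by
    refine Subtype.ext (Eq.trans ?_ hc)
    rw [mul_eq_of_mem_span_op (he.idem l)]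
    exact congrArg Subtype.val ((congrArg φ hg).symm.trans (map_smul φ _ _))
  refine ⟨c, fun x => ?_⟩
  obtain ⟨a, ha⟩ := Submodule.mem_span_singleton.1 x.2
  obtain rfl : a • g = x := Subtype.ext ha
  rw [map_smul, hφ, smul_comm]

theorem eq_zero_or_eq_id {l : Fin n} (φ : ModuleCat.of Aᵐᵒᵖ (Submodule.span Aᵐᵒᵖ {e l}) ⟶
    ModuleCat.of Aᵐᵒᵖ (Submodule.span Aᵐᵒᵖ {e l})) (hφ : φ ≫ φ = φ) : φ = 0 ∨ φ = 𝟙 _ := by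
  obtain ⟨c, hc⟩ := he.exists_apply_eq_smul φ.hom
  let g : Submodule.span Aᵐᵒᵖ {e l} := ⟨e l, Submodule.mem_span_singleton_self _⟩
  have hg : g ≠ 0 := fun h => he.ne_zero l (congrArg Subtype.val h)
  have h1 : (c * c) • g = c • g := by
    rw [mul_smul, ← hc g, ← hc (φ.hom g)]
    exact congr($hφ g)
  have h2 : c * c = c := smul_left_injective K hg h1
  obtain rfl | rfl : c = 0 ∨ c = 1 := by
    rcases eq_or_ne c 0 with h | h
    · exact Or.inl h
    · exact Or.inr (mul_left_cancel₀ h (h2.trans (mul_one c).symm))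
  · exact Or.inl (ModuleCat.hom_ext (LinearMap.ext fun x => (hc x).trans (zero_smul K x)))
  · exact Or.inr (ModuleCat.hom_ext (LinearMap.ext fun x => (hc x).trans (one_smul K x)))

/-- The image of `e k` is a nonzero element of `e l A e k`. Applied to the inverse as well, this
shows that `P(k) ≅ P(l)` forces `k = l`. -/
theorem le_of_linearEquiv {k l : Fin n} (φ : Submodule.span Aᵐᵒᵖ {e k} ≃ₗ[Aᵐᵒᵖ]
    Submodule.span Aᵐᵒᵖ {e l}) : l ≤ k := by
  let g : Submodule.span Aᵐᵒᵖ {e k} := ⟨e k, Submodule.mem_span_singleton_self _⟩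
  have hg : op (e k) • g = g := Subtype.ext (he.idem k)
  have h0 : φ g ≠ 0 := fun h =>
    he.ne_zero k (congrArg Subtype.val (φ.map_eq_zero_iff.1 h))
  refine he.le l k (φ g).1 fun h => h0 (Subtype.ext ?_)
  rw [mul_eq_of_mem_span_op (he.idem l)] at h
  rw [← hg, map_smul]
  exact h

end IsTriangularSystem

end Modules

/-! ### The bijection for a triangular algebra -/

section Assembly

open MulOpposite

variable {K : Type u} {A : Type (max u v)} [Field K] [Ring A] [Algebra K A] {n : ℕ} {e : Fin n → A}

-- The coordinate forms of a `K`-basis embed `M` into a finite power of the injective module `D(A)`.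
variable (K) in
theorem exists_injective_embedding [Module.Finite K A] (M : ModuleCat.{max u v} Aᵐᵒᵖ)
    (hM : Module.Finite Aᵐᵒᵖ M) : ∃ (E : ModuleCat.{max u v} Aᵐᵒᵖ) (ι : M ⟶ E),
      Module.Finite Aᵐᵒᵖ E ∧ Injective E ∧ Function.Injective ι := by
  let _ : Module K M := Module.restrictScalars K Aᵐᵒᵖ M
  have : IsScalarTower K Aᵐᵒᵖ M := IsScalarTower.restrictScalars K Aᵐᵒᵖ M
  have : Module.Finite K M := Module.Finite.trans Aᵐᵒᵖ M
  let b := Module.finBasis K M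
  let D := KDual K (Submodule.span A {(1 : A)})
  have : Module.Injective Aᵐᵒᵖ D := KDual.injective_span IsIdempotentElem.one
  have : Module.Finite K D :=
    inferInstanceAs (Module.Finite K (Module.Dual K (Submodule.span A {(1 : A)})))
  have : Module.Finite Aᵐᵒᵖ D := Module.Finite.of_restrictScalars_finite K Aᵐᵒᵖ D
  refine ⟨ModuleCat.of Aᵐᵒᵖ (Fin (Module.finrank K M) → D),
    ModuleCat.ofHom (LinearMap.pi fun i => KDual.lift _ (b.coord i)),
    inferInstanceAs (Module.Finite Aᵐᵒᵖ (Fin (Module.finrank K M) → D)),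
    (Module.injective_iff_injective_object Aᵐᵒᵖ _).1 inferInstance, ?_⟩
  intro x y hxy
  refine b.ext_elem fun i => ?_
  have h := congrArg (fun f : KDual K (Submodule.span A {(1 : A)}) => f (leftGen 1))
    (congrFun hxy i)
  have key (z : M) : KDual.lift (Submodule.span A {(1 : A)}) (b.coord i) z (leftGen 1) =
      b.repr z i :=
    congrArg (b.coord i) (one_smul Aᵐᵒᵖ z)
  exact (key x).symm.trans (h.trans (key y))

theorem IsTriangularSystem.exists_perm [Module.Finite K A]
    (he : IsTriangularSystem K e) (hA : IsAuslanderGorenstein A) :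
    ∃ p : Equiv.Perm (Fin n),
      (∀ j, Nonempty (MinimalProjectiveResolution
          (ModuleCat.of Aᵐᵒᵖ (KDual K (Submodule.span A {e j})))) ∧
        ∃ m : ℕ, projectiveDimension (ModuleCat.of Aᵐᵒᵖ (KDual K (Submodule.span A {e j}))) = m ∧
          ∀ r : MinimalProjectiveResolution
            (ModuleCat.of Aᵐᵒᵖ (KDual K (Submodule.span A {e j}))),
            Nonempty (r.syzygy m ≅ ModuleCat.of Aᵐᵒᵖ (Submodule.span Aᵐᵒᵖ {e (p j)}))) ∧
      ∀ j, (fun i => (peirceDim K (e (p j)) (e i) : ℝ)) ∈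
        Submodule.span ℝ ((fun i l => (peirceDim K (e l) (e i) : ℝ)) '' Set.Ici j) := by
  have : IsArtinianRing Aᵐᵒᵖ := IsArtinianRing.of_finite K Aᵐᵒᵖ
  have : IsNoetherianRing Aᵐᵒᵖ := IsNoetherianRing.of_finite K Aᵐᵒᵖ
  obtain ⟨hinj, r, hr⟩ := hA
  have hPfin (k : Fin n) :
      Module.Finite Aᵐᵒᵖ (ModuleCat.of Aᵐᵒᵖ (Submodule.span Aᵐᵒᵖ {e k})) :=
    inferInstanceAs (Module.Finite Aᵐᵒᵖ (Submodule.span Aᵐᵒᵖ {e k}))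
  choose T hT hTfin using fun k : Fin n =>
    have := hPfin k
    exists_hullSequence (R := Aᵐᵒᵖ) (exists_injective_embedding.{u, v} K)
      (ModuleCat.of Aᵐᵒᵖ (Submodule.span Aᵐᵒᵖ {e k}))
  let G := HullSequence.ofMinimalInjectiveCoresolution r
  have hretr (k : Fin n) : Nonempty (Retract ((T k).C 0) (G.C 0)) := by
    rw [hT k]
    exact retract_span (he.idem k)
  have hproj (k : Fin n) : Projective ((T k).C 0) := by
    rw [hT k]
    exact projective_span (he.idem k)
  have hJfin (i : Fin n) :
      Module.Finite Aᵐᵒᵖ (ModuleCat.of Aᵐᵒᵖ (KDual K (Submodule.span A {e i}))) := by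
    have : Module.Finite K (KDual K (Submodule.span A {e i})) :=
      inferInstanceAs (Module.Finite K (Module.Dual K (Submodule.span A {e i})))
    exact Module.Finite.of_restrictScalars_finite K Aᵐᵒᵖ (KDual K (Submodule.span A {e i}))
  have hretract (E : ModuleCat.{max u v} Aᵐᵒᵖ) (hE : Injective E) :
      letI : Module K E := Module.restrictScalars K Aᵐᵒᵖ E
      ∀ (l : Fin n) (u : E), u ≠ 0 → IsSocleElement K (e l) u →
      Nonempty (Retract (ModuleCat.of Aᵐᵒᵖ (KDual K (Submodule.span A {e l}))) E) := by
    intro l u hu0 hu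
    let _ : Module K E := Module.restrictScalars K Aᵐᵒᵖ E
    have : IsScalarTower K Aᵐᵒᵖ E := IsScalarTower.restrictScalars K Aᵐᵒᵖ E
    have : Module.Injective Aᵐᵒᵖ E := (Module.injective_iff_injective_object Aᵐᵒᵖ E).2 hE
    obtain ⟨i, r, h⟩ := he.exists_retraction hu0 hu
    exact ⟨⟨ModuleCat.ofHom i, ModuleCat.ofHom r, ModuleCat.hom_ext h⟩⟩
  obtain ⟨p, hp, hχ⟩ := exists_auslanderReiten_perm (T := T)
    (J := fun i => ModuleCat.of Aᵐᵒᵖ (KDual K (Submodule.span A {e i}))) hJfin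
    (fun i => not_subsingleton_iff_nontrivial.2 (he.nontrivial_dual i))
    (fun E _ hE h0 => by
      let _ : Module K E := Module.restrictScalars K Aᵐᵒᵖ E
      have : IsScalarTower K Aᵐᵒᵖ E := IsScalarTower.restrictScalars K Aᵐᵒᵖ E
      have := not_subsingleton_iff_nontrivial.1 h0
      obtain ⟨l, u, hu0, hu⟩ := he.exists_isSocleElement (X := E)
      exact ⟨l, hretract E hE l u hu0 hu⟩)
    (fun E _ hE i f hf => by
      let _ : Module K E := Module.restrictScalars K Aᵐᵒᵖ E
      have : IsScalarTower K Aᵐᵒᵖ E := IsScalarTower.restrictScalars K Aᵐᵒᵖ E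
      have : Nontrivial (LinearMap.range f.hom) := Submodule.nontrivial_iff_ne_bot.2 fun h =>
        hf (ModuleCat.hom_ext (LinearMap.range_eq_bot.1 h))
      obtain ⟨l, ⟨_, y, rfl⟩, hu0, hu⟩ := he.exists_isSocleElement (X := LinearMap.range f.hom)
      have hu0 : f.hom y ≠ 0 := fun h => hu0 (Subtype.ext h)
      have hu : IsSocleElement K (e l) (f.hom y) := fun a c hac => congrArg Subtype.val (hu a c hac)
      exact ⟨l, he.le_of_isSocleElement f.hom hu0 hu, hretract E hE l _ hu0 hu⟩)
    hproj
    (fun k => by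
      rw [hT k]
      exact fun φ hφ => he.eq_zero_or_eq_id φ hφ)
    (fun k hs => by
      rw [hT k] at hs
      exact he.ne_zero k (congrArg Subtype.val (Subsingleton.elim
        (⟨e k, Submodule.mem_span_singleton_self _⟩ : Submodule.span Aᵐᵒᵖ {e k}) 0)))
    (fun k l ⟨φ⟩ => by
      rw [hT k, hT l] at φ
      exact le_antisymm (he.le_of_linearEquiv φ.symm.toLinearEquiv)
        (he.le_of_linearEquiv φ.toLinearEquiv))
    hTfin
    (fun k m => by
      -- The hulls for `P(k)` are summands of the terms of the coresolution of `A` and inherit their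
      -- bounds.
      obtain ⟨h⟩ := HullSequence.nonempty_retract_E (hretr k).some m
      have : HasProjectiveDimensionLT (G.E m) (m + 1) := hr m
      exact h.hasProjectiveDimensionLT (m + 1))
    (fun k => by
      obtain ⟨d, hd⟩ := hinj
      refine (T k).exists_subsingleton_C ⟨d, ?_⟩
      have : HasInjectiveDimensionLT (G.C 0) (d + 1) := hd
      exact (hretr k).some.hasInjectiveDimensionLT (d + 1))
  refine ⟨p, fun j => ⟨?_, ?_⟩, fun j => ?_⟩
  · have := hJfin j
    exact nonempty_minimalProjectiveResolution _
  · obtain ⟨m, hm, h⟩ := hp j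
    rw [hT (p j)] at h
    exact ⟨m, hm, h⟩
  · have := hχ _ (isAdditiveFunction_dimVector K he.idem) j
    rw [hT (p j)] at this
    rw [show dimVector K e (ModuleCat.of Aᵐᵒᵖ (Submodule.span Aᵐᵒᵖ {e (p j)})) = _ from
        funext fun i => dimVector_span K (he.idem (p j)) i,
      show (fun i => dimVector K e (ModuleCat.of Aᵐᵒᵖ (KDual K (Submodule.span A {e i})))) = _ from
        funext fun i => funext fun l => dimVector_dual K (he.idem i) l] at this
    exact this

end Assembly

/-! ### Bruhat decompositions -/

section Bruhat

variable {n : ℕ}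

theorem eq_one_of_forall_apply_le (σ : Equiv.Perm (Fin n)) (h : ∀ i, σ i ≤ i) : σ = 1 := by
  ext1 i
  induction i using WellFoundedLT.induction with
  | _ i ih =>
    refine (h i).eq_of_not_lt fun hlt => hlt.ne ?_
    exact σ.injective (ih _ hlt)

theorem IsBruhatDecomposition.isUnit_factors {M U₁ P U₂ : Matrix (Fin n) (Fin n) ℝ}
    (h : IsBruhatDecomposition M U₁ P U₂) : IsUnit U₁ ∧ IsUnit U₂ := by
  have hM := h.isUnit
  rw [h.eq_mul] at hM
  simp only [Matrix.isUnit_iff_isUnit_det, IsUnit.mul_iff] at hM ⊢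
  exact ⟨hM.1.1, hM.2⟩

/-- Two decompositions give `U P = P' V` with `U`, `V` invertible upper triangular. The entry at `(p
i, i)` is nonzero on the left, which forces `p'⁻¹ (p i) ≤ i`; a permutation lying below the identity
is the identity. -/
theorem IsBruhatDecomposition.columnPermutation_unique
    {M U₁ P U₂ U₁' P' U₂' : Matrix (Fin n) (Fin n) ℝ}
    {p p' : Equiv.Perm (Fin n)} (h : IsBruhatDecomposition M U₁ P U₂)
    (h' : IsBruhatDecomposition M U₁' P' U₂') (hP : IsColumnPermutation P p)
    (hP' : IsColumnPermutation P' p') : p = p' := by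
  obtain ⟨hU₁, hU₂⟩ := IsBruhatDecomposition.isUnit_factors h
  obtain ⟨hU₁', hU₂'⟩ := IsBruhatDecomposition.isUnit_factors h'
  let _ := hU₁'.invertible
  let _ := hU₂.invertible
  have hU : (U₁'⁻¹ * U₁).IsUpperTriangular :=
    (Matrix.blockTriangular_inv_of_blockTriangular h'.upper_left).mul h.upper_left
  have hV : (U₂' * U₂⁻¹).IsUpperTriangular :=
    h'.upper_right.mul (Matrix.blockTriangular_inv_of_blockTriangular h.upper_right)
  have hUV : (U₁'⁻¹ * U₁) * P = P' * (U₂' * U₂⁻¹) := by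
    have : U₁ * P * U₂ = U₁' * P' * U₂' := h.eq_mul.symm.trans h'.eq_mul
    calc (U₁'⁻¹ * U₁) * P = U₁'⁻¹ * (U₁ * P * U₂) * U₂⁻¹ := by
          rw [Matrix.mul_assoc, Matrix.mul_assoc, Matrix.mul_assoc (U₁ * P), Matrix.mul_inv_of_invertible,
            Matrix.mul_one]
      _ = P' * (U₂' * U₂⁻¹) := by
          rw [this, Matrix.mul_assoc U₁', ← Matrix.mul_assoc (U₁'⁻¹), Matrix.inv_mul_of_invertible,
            Matrix.one_mul, Matrix.mul_assoc]
  have hUunit : IsUnit (U₁'⁻¹ * U₁) := (Matrix.isUnit_nonsing_inv_iff.2 hU₁').mul hU₁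
  have hdiag (k : Fin n) : (U₁'⁻¹ * U₁) k k ≠ 0 := by
    rw [Matrix.isUnit_iff_isUnit_det, Matrix.det_of_isUpperTriangular hU, isUnit_iff_ne_zero,
      Finset.prod_ne_zero_iff] at hUunit
    exact hUunit k (Finset.mem_univ k)
  have hle (i : Fin n) : p'⁻¹ (p i) ≤ i := by
    by_contra hlt
    have h1 := congrFun (congrFun hUV (p i)) i
    rw [Matrix.mul_apply, Matrix.mul_apply, Finset.sum_eq_single (p i), Finset.sum_eq_zero] at h1
    · exact mul_ne_zero (hdiag _) ((hP i (p i)).2 rfl) h1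
    · intro m _
      by_cases hm : P' (p i) m = 0
      · rw [hm, zero_mul]
      · have : p'⁻¹ (p i) = m := by
          rw [(hP' _ _).1 hm, Equiv.Perm.inv_def, Equiv.symm_apply_apply]
        rw [this] at hlt
        rw [hV (not_le.1 hlt), mul_zero]
    · intro m _ hm
      rw [not_not.1 (mt (hP i m).1 hm), mul_zero]
    · simp
  have := eq_one_of_forall_apply_le (p'⁻¹ * p) hle
  exact (inv_mul_eq_one.1 this).symm

/-- If `ω` is lower unitriangular and each column `p j` of `ω` is a linear combination of the rows
`i ≥ j` of `ω`, then `-ωᵀ ω⁻¹` has a Bruhat decomposition with permutation `p` and trivial left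
factor. -/
theorem exists_isBruhatDecomposition {ω : Matrix (Fin n) (Fin n) ℝ} (hdiag : ∀ i, ω i i = 1)
    (hlower : ∀ i j, ¬ j ≤ i → ω i j = 0) (p : Equiv.Perm (Fin n))
    (hp : ∀ j, (fun i => ω i (p j)) ∈ Submodule.span ℝ ((fun i l => ω i l) '' Set.Ici j)) :
    ∃ P U : Matrix (Fin n) (Fin n) ℝ,
      IsBruhatDecomposition (-(ω.transpose * ω⁻¹)) 1 P U ∧ IsColumnPermutation P p := by
  have hdetT : ω.transpose.det = 1 := by
    rw [Matrix.det_of_isUpperTriangular (M := ω.transpose) fun i j hij => hlower j i (not_le.2 hij)]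
    exact Finset.prod_eq_one fun i _ => hdiag i
  have hdet : IsUnit ω.det := by
    rw [← Matrix.det_transpose, hdetT]
    exact isUnit_one
  have hB (j : Fin n) : ∃ b : Fin n → ℝ, (∀ i, i < j → b i = 0) ∧
      ∀ l, ω l (p j) = ∑ i, b i * ω i l := by
    obtain ⟨b, hb, h⟩ := (Finsupp.mem_span_image_iff_linearCombination ℝ).1 (hp j)
    refine ⟨b, fun i hij => ?_, fun l => ?_⟩
    · by_contra h0
      exact absurd ((Finsupp.mem_supported ℝ b).1 hb (Finsupp.mem_support_iff.2 h0)) (not_le.2 hij)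
    · rw [← congrFun h l, Finsupp.linearCombination_apply, Finsupp.sum_fintype _ _ (by simp)]
      simp
  choose b hb0 hb using hB
  let B : Matrix (Fin n) (Fin n) ℝ := Matrix.of b
  -- `permMatrix` places the 1 of row `j` in column `p j`, so the matrix with column-permutation `p`
  -- is that of `p⁻¹`.
  let P : Matrix (Fin n) (Fin n) ℝ := (p⁻¹).permMatrix ℝ
  have hBω : p.permMatrix ℝ * ω.transpose = B * ω := by
    ext j l
    rw [PEquiv.toMatrix_toPEquiv_mul]
    exact hb j l
  have hPP : P * p.permMatrix ℝ = 1 := by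
    rw [← Matrix.permMatrix_mul, mul_inv_cancel, Matrix.permMatrix_one]
  have key : ω.transpose * ω⁻¹ = P * B := by
    calc ω.transpose * ω⁻¹ = P * (p.permMatrix ℝ * ω.transpose) * ω⁻¹ := by
          rw [← Matrix.mul_assoc, hPP, Matrix.one_mul]
      _ = P * B := by
          rw [hBω, ← Matrix.mul_assoc, Matrix.mul_nonsing_inv_cancel_right _ _ hdet]
  refine ⟨P, -B, ⟨?_, ?_, Matrix.blockTriangular_one, ?_, p⁻¹, rfl⟩, fun i j => ?_⟩
  · refine IsUnit.neg (((Matrix.isUnit_iff_isUnit_det _).2 ?_).mul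
      ((Matrix.isUnit_iff_isUnit_det _).2 (Matrix.isUnit_nonsing_inv_det _ hdet)))
    rw [hdetT]
    exact isUnit_one
  · rw [key, Matrix.one_mul, Matrix.mul_neg]
  · intro i j hij
    simpa [B] using hb0 i j hij
  · simp only [P, Equiv.Perm.permMatrix, PEquiv.toMatrix_apply, Equiv.toPEquiv_apply]
    simp [Equiv.symm_apply_eq]

end Bruhat

/-! ### Quiver algebras as triangular algebras -/

section QuiverAlgebra

theorem finite_paths_of_length {V : Type v} [Quiver.{w} V] [Finite V] [∀ i j : V, Finite (i ⟶ j)]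
    (m : ℕ) (a b : V) : Finite {p : Quiver.Path a b // p.length = m} := by
  induction m generalizing b with
  | zero =>
    refine @Finite.of_subsingleton _ ⟨?_⟩
    rintro ⟨p, hp⟩ ⟨q, hq⟩
    obtain rfl := Quiver.Path.eq_of_length_zero p hp
    exact Subtype.ext ((Quiver.Path.eq_nil_of_length_zero p hp).trans
      (Quiver.Path.eq_nil_of_length_zero q hq).symm)
  | succ m ih =>
    refine Finite.of_surjective (α := Σ c : V, {p : Quiver.Path a c // p.length = m} × (c ⟶ b))
      (fun x => ⟨x.2.1.1.cons x.2.2, by rw [Quiver.Path.length_cons, x.2.1.2]⟩) ?_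
    rintro ⟨p, hp⟩
    cases p with
    | nil => simp at hp
    | cons q f => exact ⟨⟨_, ⟨q, by simpa using hp⟩, f⟩, rfl⟩

namespace PathAlgebra

variable {K : Type u} {V : Type v} [Field K] [Quiver.{w} V]

theorem coeff_vertex (i : V) : (vertex i : PathAlgebra K V).coeff ⟨i, i, Quiver.Path.nil⟩ = 1 := by
  simp [coeff, vertex, ofPath]

variable [DecidableEq V]

theorem vertex_mul_vertex_self (i : V) : (vertex i * vertex i : PathAlgebra K V) = vertex i := by
  rw [vertex, ofPath_mul_ofPath, pathMul_of_eq, Quiver.Path.comp_nil]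

theorem vertex_mul_vertex_of_ne {i j : V} (h : i ≠ j) :
    (vertex i * vertex j : PathAlgebra K V) = 0 := by
  rw [vertex, vertex, ofPath_mul_ofPath, pathMul_of_ne h]

theorem vertex_mul_ofPath_mul_vertex {i j : V} (p : Quiver.Path i j) :
    (vertex i * ofPath ⟨i, j, p⟩ * vertex j : PathAlgebra K V) = ofPath ⟨i, j, p⟩ := by
  rw [vertex, vertex, ofPath_mul_ofPath, pathMul_of_eq, ofPath_mul_ofPath, pathMul_of_eq,
    Quiver.Path.nil_comp, Quiver.Path.comp_nil]

variable [Fintype V]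

theorem vertex_mul_ofPath_mul_vertex_of_ne {i j : V} {p : QuiverPath V}
    (h : ¬ (p.source = i ∧ p.target = j)) :
    (vertex i * ofPath p * vertex j : PathAlgebra K V) = 0 := by
  obtain ⟨a, b, p⟩ := p
  by_cases ha : a = i
  · subst ha
    rw [vertex, vertex, ofPath_mul_ofPath, pathMul_of_eq, ofPath_mul_ofPath,
      pathMul_of_ne fun hb => h ⟨rfl, hb⟩]
  · rw [vertex, ofPath_mul_ofPath, pathMul_of_ne (Ne.symm ha), zero_mul]

theorem vertex_mul_mul_vertex_self (hV : IsAcyclicQuiver V) (i : V) (x : PathAlgebra K V) :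
    ∃ c : K, vertex i * x * vertex i = c • vertex i := by
  induction x using induction_linear with
  | zero => exact ⟨0, by simp⟩
  | add x y hx hy =>
    obtain ⟨c, hc⟩ := hx
    obtain ⟨d, hd⟩ := hy
    exact ⟨c + d, by rw [mul_add, add_mul, hc, hd, add_smul]⟩
  | smul c p =>
    by_cases h : p.source = i ∧ p.target = i
    · obtain ⟨a, b, p⟩ := p
      obtain ⟨rfl, rfl⟩ : a = i ∧ b = i := h
      refine ⟨c, ?_⟩
      rw [mul_smul_comm, smul_mul_assoc, vertex_mul_ofPath_mul_vertex,
        Quiver.Path.eq_nil_of_length_zero p (hV _ p), vertex]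
    · exact ⟨0, by rw [mul_smul_comm, smul_mul_assoc, vertex_mul_ofPath_mul_vertex_of_ne h,
        smul_zero, zero_smul]⟩

theorem vertex_mul_mul_vertex_of_isEmpty {i j : V} (h : IsEmpty (Quiver.Path i j))
    (x : PathAlgebra K V) : vertex i * x * vertex j = 0 := by
  induction x using induction_linear with
  | zero => simp
  | add x y hx hy => rw [mul_add, add_mul, hx, hy, add_zero]
  | smul c p =>
    rw [mul_smul_comm, smul_mul_assoc, vertex_mul_ofPath_mul_vertex_of_ne, smul_zero]
    rintro ⟨rfl, rfl⟩
    exact h.false p.path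

end PathAlgebra

variable {K : Type u} {V : Type v} [Field K] [Quiver.{w} V] [Fintype V] [DecidableEq V]
  {I : Ideal (PathAlgebra K V)} [I.IsTwoSided]

theorem finite_quiverAlgebra [∀ i j : V, Finite (i ⟶ j)] (hI : IsAdmissible I) :
    Module.Finite K (PathAlgebra K V ⧸ I) := by
  obtain ⟨m, -, hm⟩ := hI.pow_le
  have hfin : {p : QuiverPath V | p.path.length < m}.Finite := by
    have := fun (l : ℕ) (a b : V) => finite_paths_of_length l a b
    refine Set.Finite.subset (Set.finite_range
      fun x : Σ l : Fin m, Σ a b : V, {p : Quiver.Path a b // p.length = l} =>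
        (⟨x.2.1, x.2.2.1, x.2.2.2.1⟩ : QuiverPath V)) fun p hp => ?_
    exact ⟨⟨⟨_, hp⟩, p.source, p.target, p.path, rfl⟩, rfl⟩
  let π : PathAlgebra K V →ₗ[K] PathAlgebra K V ⧸ I := (Ideal.Quotient.mkₐ K I).toLinearMap
  refine ⟨Submodule.fg_def.2 ⟨(fun p => π (PathAlgebra.ofPath p)) '' _, hfin.image _, ?_⟩⟩
  rw [eq_top_iff]
  rintro x -
  obtain ⟨x, rfl⟩ := Ideal.Quotient.mk_surjective x
  induction x using PathAlgebra.induction_linear with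
  | zero => exact zero_mem _
  | add x y hx hy =>
    rw [map_add]
    exact add_mem hx hy
  | smul c p =>
    change π (c • PathAlgebra.ofPath p) ∈ _
    rw [map_smul]
    refine Submodule.smul_mem _ _ ?_
    by_cases hp : p.path.length < m
    · exact Submodule.subset_span ⟨p, hp, rfl⟩
    · have : π (PathAlgebra.ofPath p) = 0 := Ideal.Quotient.eq_zero_iff_mem.2 (hm p (not_lt.1 hp))
      rw [this]
      exact zero_mem _

/-- Acyclicity gives `e_i A e_i = K e_i`, the labelling gives the order, and `I ⊆ J ^ 2` contains no
path of length zero, so the idempotents survive. -/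
theorem isTriangularSystem_idem (hV : IsAcyclicQuiver V) (hI : IsAdmissible I) {n : ℕ}
    {label : Fin n ≃ V} (hlabel : IsNaturalLabelling label) :
    IsTriangularSystem K fun i => idem I (label i) where
  idem i := by
    rw [IsIdempotentElem, idem, ← map_mul, PathAlgebra.vertex_mul_vertex_self]
  ortho i j hij := by
    dsimp only
    rw [idem, idem, ← map_mul, PathAlgebra.vertex_mul_vertex_of_ne (label.injective.ne hij),
      map_zero]
  complete := by
    rw [label.sum_comp (fun v => idem I v), ← map_one (Ideal.Quotient.mk I), PathAlgebra.one_def,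
      map_sum]
    rfl
  ne_zero i h := by
    have h1 := hI.le_sq _ (Ideal.Quotient.eq_zero_iff_mem.1 h) ⟨label i, label i, Quiver.Path.nil⟩
      (by rw [PathAlgebra.coeff_vertex]; exact one_ne_zero)
    simp at h1
  exists_smul i a := by
    obtain ⟨x, rfl⟩ := Ideal.Quotient.mk_surjective a
    obtain ⟨c, hc⟩ := PathAlgebra.vertex_mul_mul_vertex_self hV (label i) x
    refine ⟨c, ?_⟩
    rw [idem, ← map_mul, ← map_mul, hc]
    rfl
  le i j a h := by
    by_contra hij
    obtain ⟨x, rfl⟩ := Ideal.Quotient.mk_surjective a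
    refine h ?_
    rw [idem, idem, ← map_mul, ← map_mul, PathAlgebra.vertex_mul_mul_vertex_of_isEmpty, map_zero]
    refine ⟨fun p => hij ?_⟩
    by_cases hne : i = j
    · exact hne.le
    · exact (hlabel i j hne ⟨p⟩).le

end QuiverAlgebra

theorem mainTheorem3 {K : Type u} {V : Type v} [Field K] [Quiver.{w} V] [Fintype V]
    [DecidableEq V] [∀ i j : V, Finite (i ⟶ j)] (hV : IsAcyclicQuiver V)
    (I : Ideal (PathAlgebra K V)) [I.IsTwoSided] (hI : IsAdmissible I)
    {n : ℕ} (label : Fin n ≃ V) (hlabel : IsNaturalLabelling label)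
    (hA : IsAuslanderRegular (PathAlgebra K V ⧸ I)) :
    (∃ P U₂ : Matrix (Fin n) (Fin n) ℝ,
      IsBruhatDecomposition (coxeterMatrix I label) 1 P U₂) ∧
    ∃ p : Equiv.Perm (Fin n),
      (∀ q : Equiv.Perm (Fin n), IsCoxeterPermutation I label q ↔ q = p) ∧
      (∀ q : Equiv.Perm (Fin n), IsAuslanderReitenPermutation I label q ↔ q = p) := by
  have := finite_quiverAlgebra hI
  have he := isTriangularSystem_idem hV hI hlabel
  obtain ⟨p, hp, hspan⟩ := IsTriangularSystem.exists_perm.{u, max v w} he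
    hA.toIsAuslanderGorenstein
  -- Row `i` of ω is the dimension vector of `I(i)` and column `j` that of `P(j)`, so `hspan` is the
  -- required relation between columns and rows.
  obtain ⟨P, U, hPU, hP⟩ := exists_isBruhatDecomposition (ω := cartanMatrix I label)
    (fun i => congrArg Nat.cast (he.peirceDim_self i) |>.trans Nat.cast_one)
    (fun i j hij => congrArg Nat.cast (he.peirceDim_eq_zero hij) |>.trans Nat.cast_zero) p hspan
  refine ⟨⟨P, U, hPU⟩, p, fun q => ⟨?_, ?_⟩, fun q => ⟨fun hq => ?_, ?_⟩⟩
  · rintro ⟨U₁', P', U₂', h', hq⟩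
    exact h'.columnPermutation_unique hPU hq hP
  · rintro rfl
    exact ⟨1, P, U, hPU, hP⟩
  · refine Equiv.ext fun i => ?_
    obtain ⟨d, r, hd, ⟨φ⟩⟩ := hq i
    obtain ⟨-, m, hm, h⟩ := hp i
    obtain rfl : d = m := by exact_mod_cast hd.symm.trans hm
    obtain ⟨ψ⟩ := h r
    have θ := φ.symm ≪≫ ψ
    exact le_antisymm (he.le_of_linearEquiv θ.symm.toLinearEquiv)
      (he.le_of_linearEquiv θ.toLinearEquiv)
  · rintro rfl i
    obtain ⟨⟨r⟩, m, hm, h⟩ := hp i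
    exact ⟨m, r, hm, h r⟩
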